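/- **Setting.** Let $\Omega\subset\mathbb R^r$ be a polyhedral domain with a conforming simplicial triangulation $\mathcal T_h$ that is shape regular with constant $\sigma$ (every $\tau\in\mathcal T_h$ contains a ball of radius $R_\tau>0$ with $\operatorname{diam}\tau\le\sigma R_\tau$). Let $V_h$ be the space of continuous functions on $\overline\Omega$ that are linear on each $\tau\in\mathcal T_h$ and vanish on $\partial\Omega$. Let $\rho>0$ be a measurable coefficient that satisfies $\rho(x)\le K\rho(y)$ for all $x,y$ in the interior of the same $\tau\in\mathcal T_h$. Write $|v|_{a(R)}^2=\int_R\rho|\nabla v|^2\,dx$ and $a(v,w)=\int_\Omega\rho\nabla v\cdot\nabla w\,dx$. Let $\Omega$ be partitioned into nonoverlapping subdomains $\Omega_1,\dots,\Omega_N$, each a connected union of elements of $\mathcal T_h$. Put $\Omega_{i,0}=\Omega_i$ and let $\Omega_{i,k+1}$ be the union of all closed subdomains $\Omega_l$ that touch $\Omega_{i,k}$. Let $\Omega_l'$ be overlapping subdomains, each a union of elements with $\Omega_l\subset\Omega_l'\subset\Omega_{l,1}$ (for instance $\Omega_l$ extended by several layers of elements), such that every element lies in at most $M$ of them. Let $\theta_l\ge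 0$ be continuous, linear on each element and zero outside $\Omega_l'$, with $\sum_l\theta_l(x)=1$ at every mesh node $x$ in the interior of $\Omega$. With $V(\Omega_i)$ the space of restrictions to $\Omega_i$ of functions in $V_h$, and $n(i)$ the set of $l$ such that the support of $\theta_l$ meets $\Omega_i$, let $$a_i(v,w)=\int_{\Omega_i}\rho\,\nabla v\cdot\nabla w\,dx,\qquad s_i(v,w)=\int_{\Omega_i}\rho\sum_{l\in n(i)}|\nabla\theta_l|^2\,v\,w\,dx .$$ Given a tolerance $\Lambda>0$, let $\phi_1^{(i)},\dots,\phi_{l_i}^{(i)}\in V(\Omega_i)$ be all the ($s_i$-orthonormal) eigenfunctions of $a_i(\phi,w)=\lambda s_i(\phi,w)$ for all $w\in V(\Omega_i)$ with eigenvalue $\lambda<\Lambda$; that is, a maximal $s_i$-orthonormal family of such eigenfunctions, in ascending order of the eigenvalues. Maximality means that every eigenfunction $w$ with eigenvalue less than $\Lambda$ that is $s_i$-orthogonal to all the $\phi_j^{(i)}$ satisfies $s_i(w,w)=0$. Put $\pi_kv=\sum_{j=1}^{l_k}s_k(v,\phi_j^{(k)})\phi_j^{(k)}$ and $\|v\|_{s_k}^2=s_k(v,v)$.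 Let the global coarse basis function $\psi_j^{(i)}$ be the minimizer over $\psi\in V_h$ of $$a(\psi,\psi)+\|\pi_i\psi-\phi_j^{(i)}\|_{s_i}^2+\sum_{k\ne i}\|\pi_k\psi\|_{s_k}^2 .$$ **Lemma (exponential decay).** There is a constant $C>0$ that depends only on $r$, $\sigma$, $K$ and $M$ such that in every such setting, for every $i$, every $j\le l_i$, and every $k=2m$ with $m\ge1$, $$|\psi_j^{(i)}|_{a(\Omega\setminus\Omega_{i,k})}^2+\sum_{\Omega_l\subset\Omega\setminus\Omega_{i,k}}\|\pi_l\psi_j^{(i)}\|_{s_l}^2\;\le\;E^{-m}\Bigl(|\psi_j^{(i)}|_{a(\Omega)}^2+\sum_{l}\|\pi_l\psi_j^{(i)}\|_{s_l}^2\Bigr),$$ where $E=1+\bigl(C(1+\Lambda^{-1})\bigr)^{-1}>1$. The sum on the left is over the subdomains $\Omega_l$ that are not part of $\Omega_{i,k}$. -/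

import Mathlib

open Set MeasureTheory

noncomputable section

namespace MultiscaleSchwarz

/-- The space `ℝ^r` with its Euclidean norm. -/
abbrev Space (r : ℕ) : Type := EuclideanSpace ℝ (Fin r)

/-! ### Triangulations and finite element functions -/

/-- A conforming triangulation of a polyhedral domain in `ℝ^r`: a finite simplicial complex all of
whose simplices are faces of `r`-dimensional ones, with connected interior. -/
structure Triangulation (r : ℕ) where
  complex : Geometry.SimplicialComplex ℝ (Space r)
  finite : complex.faces.Finite
  pure : ∀ s ∈ complex.faces, ∃ t ∈ complex.faces, s ⊆ t ∧ t.card = r + 1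
  connected : IsConnected (interior complex.space)

namespace Triangulation

variable {r : ℕ} (T : Triangulation r)

/-- The (open) domain `Ω`. -/
def domain : Set (Space r) := interior T.complex.space

/-- The elements of the triangulation, each given by the set of its `r + 1` vertices. -/
def elements : Set (Finset (Space r)) := {t | t ∈ T.complex.faces ∧ t.card = r + 1}

/-- The closed simplex with vertex set `t`. -/
def _root_.MultiscaleSchwarz.cell {r : ℕ} (t : Finset (Space r)) : Set (Space r) :=
  convexHull ℝ (t : Set (Space r))

/-- The closed region covered by a collection of simplices. -/
def _root_.MultiscaleSchwarz.region {r : ℕ} (S : Set (Finset (Space r))) : Set (Space r) :=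
  ⋃ t ∈ S, cell t

/-- Shape regularity: every element contains a ball whose radius is at least `1 / σ` times the
diameter of the element. -/
def ShapeRegular (σ : ℝ) : Prop :=
  ∀ t ∈ T.elements, ∃ (c : Space r) (R : ℝ), 0 < R ∧ Metric.closedBall c R ⊆ cell t ∧
    Metric.diam (cell t) ≤ σ * R

/-- The function agrees on every closed element with an affine function
(hence it is continuous on the closure of the domain). -/
def IsPiecewiseLinear (v : Space r → ℝ) : Prop :=
  ∀ t ∈ T.elements, ∃ g : Space r →ᵃ[ℝ] ℝ, EqOn v g (cell t)

/-- The space `V_h` of continuous piecewise linear functions with zero value on `∂Ω`. Its elements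
are regarded as functions on `ℝ^r`, extended by zero outside the domain. -/
def femSpace : Set (Space r → ℝ) :=
  {v | T.IsPiecewiseLinear v ∧ ∀ x ∉ T.domain, v x = 0}

/-- A measurable positive coefficient `ρ` with
`max_τ ρ / min_τ ρ ≤ K` on every element `τ`. The values of `ρ` on the element boundaries are
irrelevant, so that `ρ` may jump across them. -/
structure IsCoefficient (K : ℝ) (ρ : Space r → ℝ) : Prop where
  measurable : Measurable ρ
  pos : ∀ t ∈ T.elements, ∀ x ∈ interior (cell t), 0 < ρ x
  ratio : ∀ t ∈ T.elements, ∀ x ∈ interior (cell t), ∀ y ∈ interior (cell t), ρ x ≤ K * ρ y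

end Triangulation

/-- `∫_R ρ ∇v · ∇w dx`. -/
def energyForm {r : ℕ} (ρ : Space r → ℝ) (R : Set (Space r)) (v w : Space r → ℝ) : ℝ :=
  ∫ x in R, ρ x * inner ℝ (gradient v x) (gradient w x)

/-! ### Subdomains, coarse layers, overlapping subdomains, partition of unity -/

/-- A partition of the domain into nonoverlapping subdomains `Ω_1, …, Ω_N`, each of which is a
connected union of elements; `part i` is the set of elements of `Ω_i`. -/
structure Subdomains {r : ℕ} (T : Triangulation r) (N : ℕ) where
  part : Fin N → Set (Finset (Space r))
  disjoint : Pairwise fun i l => Disjoint (part i) (part l)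
  cover : ⋃ i, part i = T.elements
  connected : ∀ i, IsConnected (region (part i))

namespace Subdomains

variable {r : ℕ} {T : Triangulation r} {N : ℕ} (P : Subdomains T N)

/-- The closed subdomain `Ω_i`. -/
def sub (i : Fin N) : Set (Space r) := region (P.part i)

/-- The indices of the subdomains that make up `Ω_{i,k}`: starting from `Ω_i`, one adds `k` times
all the subdomains that touch the region obtained so far. -/
def layers (i : Fin N) : ℕ → Set (Fin N)
  | 0 => {i}
  | k + 1 => {l | ∃ p ∈ layers i k, (P.sub l ∩ P.sub p).Nonempty}

/-- The closed region `Ω_{i,k}`, that is `Ω_i` extended by `k` layers of neighbouring subdomains. -/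
def layerRegion (i : Fin N) (k : ℕ) : Set (Space r) := ⋃ l ∈ P.layers i k, P.sub l

/-- The space `V(Ω_i)` of restrictions to `Ω_i` of the functions of `V_h`
(a function on `Ω_i` is regarded as a function on `ℝ^r` by putting it to zero elsewhere). -/
def localSpace (i : Fin N) : Set (Space r → ℝ) := (fun v => (P.sub i).indicator v) '' T.femSpace

end Subdomains

/-- An overlapping subdomain partition: `Ω_l'` is a union of elements, it contains `Ω_l` and does
not reach beyond the subdomains that touch `Ω_l`. This covers the extension of `Ω_l` by any number
of layers of elements as long as the overlap is narrower than a layer of subdomains. -/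
structure Overlap {r : ℕ} {T : Triangulation r} {N : ℕ} (P : Subdomains T N) where
  ext : Fin N → Set (Finset (Space r))
  part_subset : ∀ l, P.part l ⊆ ext l
  subset_layer : ∀ l, ext l ⊆ ⋃ p ∈ P.layers l 1, P.part p

namespace Overlap

variable {r : ℕ} {T : Triangulation r} {N : ℕ} {P : Subdomains T N} (O : Overlap P)

/-- The closed overlapping subdomain `Ω_l'`. -/
def sub (l : Fin N) : Set (Space r) := region (O.ext l)

/-- Every element belongs to at most `M` of the overlapping subdomains. -/
def MultiplicityLE (M : ℕ) : Prop := ∀ t ∈ T.elements, {l | t ∈ O.ext l}.ncard ≤ M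

/-- A partition of unity subordinate to the overlapping subdomains: `θ_l` is nonnegative and
piecewise linear on the triangulation, it vanishes outside `Ω_l'`, and `∑ θ_l = 1` at all the mesh
nodes inside the domain. Nothing more is required at nodes on `∂Ω`, so that both `∑ θ_l = 1`
on the whole domain and `θ_l = 0` on `∂Ω` are allowed. -/
structure IsPartitionOfUnity (θ : Fin N → Space r → ℝ) : Prop where
  piecewiseLinear : ∀ l, T.IsPiecewiseLinear (θ l)
  nonneg : ∀ l x, 0 ≤ θ l x
  supported : ∀ l, ∀ x ∉ O.sub l, θ l x = 0
  sum_eq_one : ∀ x ∈ T.complex.vertices, x ∈ T.domain → ∑ l, θ l x = 1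

end Overlap

namespace Subdomains

variable {r : ℕ} {T : Triangulation r} {N : ℕ} (P : Subdomains T N)
  (ρ : Space r → ℝ) (θ : Fin N → Space r → ℝ)

/-- `a_i(v,w) = ∫_{Ω_i} ρ ∇v · ∇w dx`. -/
def aForm (i : Fin N) (v w : Space r → ℝ) : ℝ := energyForm ρ (P.sub i) v w

open Classical in
/-- The set `n(i)` of the indices `l` such that the support of `θ_l` meets `Ω_i`. -/
def overlapIndices (i : Fin N) : Finset (Fin N) :=
  {l | (Function.support (θ l) ∩ P.sub i).Nonempty}

/-- `s_i(v,w) = ∫_{Ω_i} ρ ∑_{l ∈ n(i)} |∇θ_l|² v w dx`. -/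
def sForm (i : Fin N) (v w : Space r → ℝ) : ℝ :=
  ∫ x in P.sub i, ρ x * (∑ l ∈ P.overlapIndices θ i, ‖gradient (θ l) x‖ ^ 2) * v x * w x

/-- The selected eigenfunctions of all subdomains. On each `Ω_i` they form a maximal
`s_i`-orthonormal family of eigenfunctions `φ_1, …, φ_{l_i}` in `V(Ω_i)` of the generalized
eigenvalue problem `a_i(φ, w) = λ s_i(φ, w)` with eigenvalue `λ < Λ`, in ascending order.
Since `s_i` may be degenerate, maximality says that an eigenfunction `w` with eigenvalue less
than `Λ` which is `s_i`-orthogonal to all of them satisfies `s_i(w, w) = 0`. -/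
structure AuxiliaryBasis (Λ : ℝ) where
  num : Fin N → ℕ
  eigenvalue : ∀ i, Fin (num i) → ℝ
  fn : ∀ i, Fin (num i) → Space r → ℝ
  mem : ∀ i j, fn i j ∈ P.localSpace i
  eigen : ∀ i j, ∀ w ∈ P.localSpace i,
    P.aForm ρ i (fn i j) w = eigenvalue i j * P.sForm ρ θ i (fn i j) w
  ascending : ∀ i, Monotone (eigenvalue i)
  eigenvalue_lt : ∀ i j, eigenvalue i j < Λ
  orthonormal : ∀ i j l, P.sForm ρ θ i (fn i j) (fn i l) = if j = l then 1 else 0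
  maximal : ∀ i, ∀ μ < Λ, ∀ w ∈ P.localSpace i,
    (∀ z ∈ P.localSpace i, P.aForm ρ i w z = μ * P.sForm ρ θ i w z) →
    (∀ j, P.sForm ρ θ i w (fn i j) = 0) → P.sForm ρ θ i w w = 0

namespace AuxiliaryBasis

variable {P ρ θ} {Λ : ℝ} (B : P.AuxiliaryBasis ρ θ Λ)

/-- `π_k v = ∑_j s_k(v, φ_j^{(k)}) φ_j^{(k)}`. -/
def proj (k : Fin N) (v : Space r → ℝ) : Space r → ℝ :=
  fun x => ∑ j, P.sForm ρ θ k v (B.fn k j) * B.fn k j x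

/-- `‖π_k v‖_{s_k}^2 = s_k(π_k v, π_k v)`. -/
def projNormSq (k : Fin N) (v : Space r → ℝ) : ℝ := P.sForm ρ θ k (B.proj k v) (B.proj k v)

/-- The functional
`a(v,v) + s_i(π_i v - φ_j^{(i)}, π_i v - φ_j^{(i)}) + ∑_{k ≠ i} s_k(π_k v, π_k v)`. -/
def functional (i : Fin N) (j : Fin (B.num i)) (v : Space r → ℝ) : ℝ :=
  energyForm ρ T.domain v v
    + P.sForm ρ θ i (B.proj i v - B.fn i j) (B.proj i v - B.fn i j)
    + ∑ k ∈ Finset.univ.erase i, B.projNormSq k v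

/-- `ψ` is the global coarse basis function `ψ_j^{(i)}`, the minimizer over `V_h` of the relaxed
constrained energy. -/
def IsGlobalBasisFunction (i : Fin N) (j : Fin (B.num i)) (ψ : Space r → ℝ) : Prop :=
  ψ ∈ T.femSpace ∧ ∀ v ∈ T.femSpace, B.functional i j ψ ≤ B.functional i j v

open Classical in
/-- `|v|_{a(Ω ∖ Ω_{i,k})}^2 + ∑ ‖π_l v‖_{s_l}^2`, with the sum over the subdomains `Ω_l` in
`Ω ∖ Ω_{i,k}`. -/
def outerEnergy (i : Fin N) (k : ℕ) (v : Space r → ℝ) : ℝ :=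
  energyForm ρ (T.domain \ P.layerRegion i k) v v
    + ∑ l with l ∉ P.layers i k, B.projNormSq l v

/-- `|v|_{a(Ω)}^2 + ∑_l ‖π_l v‖_{s_l}^2`. -/
def totalEnergy (v : Space r → ℝ) : ℝ :=
  energyForm ρ T.domain v v + ∑ l, B.projNormSq l v

end AuxiliaryBasis

end Subdomains

end MultiscaleSchwarz

end

/-!
The global basis function `ψ` satisfies a variational equation `∑_l d_l(ψ, v) = s_i(v, φ_j)` for all
`v ∈ V_h`, where `d_l(v, w) = a_l(v, w) + s_l(π_l v, π_l w)` is a semidefinite form that sees only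
the values on `Ω_l`. Its total energy is `∑_l d_l(ψ, ψ)`, and the energy outside `Ω_{i,k}` is the
part `F_k` of this sum over the subdomains outside `Ω_{i,k}`. The equation is tested with the nodal
interpolant `v` of `χ ψ`, where `χ = 1 - ∑ θ_l` and `l` runs through the subdomains of
`Ω_{i,k+1}`. As `θ_l` is active only on subdomains that touch `Ω_l`, the function `v` vanishes on
`Ω_{i,k}`, hence also the right-hand side, and equals `ψ` outside `Ω_{i,k+2}` (`cutoff_eqOn`).
What remains is `F_{k+2} = -∑ d_l(ψ, v)` over the two layers in between, and if
`d_l(v, v) ≤ C (1 + Λ⁻¹) d_l(ψ, ψ)` with `C ≥ 1`, then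
`F_{k+2} ≤ C (1 + Λ⁻¹) (F_k - F_{k+2})` (`outerEnergy_step`), which gives the decay by iteration.

The bound on `d_l(v, v)` has three ingredients.

* By Bessel's inequality `d_l ≤ a_l + s_l` on the diagonal (`localForm_self_le`).
* On one element, `(a + s)(v, v) ≤ C (a + s)(ψ, ψ)` (`element_cutoff_le`). The slope of the affine
  interpolant is bounded by its oscillation over the nodes divided by the radius of an inscribed
  ball, and the nodal values of `ψ` are bounded by its `L²` norm: an affine function keeps half of
  its maximal nodal value on a copy of the simplex scaled by `1 / 4` towards that node
  (`volume_mul_sq_le_integral_sq`). At nodes on `∂Ω` the cutoff may leave `[0, 1]`, but `ψ` is zero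
  there.
* `a_l + s_l ≤ (1 + Λ⁻¹) d_l` on the diagonal (`aForm_add_sForm_le`), since all the eigenfunctions
  below `Λ` are contained in `π_l` (`spectral_gap`). The forms may be degenerate, so the proof
  maximizes `s / (a + s)` on the `s`-orthogonal complement of the eigenfunctions, modulo the common
  kernel; a maximizer that violates the claim would be an eigenfunction that was left out.

That the interpolant lies in `V_h` requires its vanishing on `∂Ω`, not only at the boundary nodes.
This holds because a face with a vertex in the open domain has its relative interior in the domain
(`mem_domain_of_coord_pos`).
-/

namespace MultiscaleSchwarz

/-! ### Semidefinite forms and the spectral gap -/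

section LinearAlgebra

variable {V : Type*} [AddCommGroup V] [Module ℝ V]

/-- A null vector of a semidefinite form lies in its kernel, by the Cauchy-Schwarz inequality. -/
lemma bilin_eq_zero_of_self_eq_zero {b : LinearMap.BilinForm ℝ V} (hb : ∀ x, 0 ≤ b x x)
    (hsymm : ∀ x y, b x y = b y x) {x : V} (hx : b x x = 0) (y : V) : b x y = 0 := by
  have h := LinearMap.BilinForm.apply_sq_le_of_symm b hb ⟨fun x y => by simpa using hsymm x y⟩ x y
  rw [hx, zero_mul] at h
  exact pow_eq_zero_iff two_ne_zero |>.1 (le_antisymm h (sq_nonneg _))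

lemma continuous_bilin_self {E : Type*} [NormedAddCommGroup E] [NormedSpace ℝ E]
    [FiniteDimensional ℝ E] (b : LinearMap.BilinForm ℝ E) : Continuous fun x => b x x := by
  let f : E →L[ℝ] (E →L[ℝ] ℝ) := LinearMap.toContinuousLinearMap
    ((LinearMap.toContinuousLinearMap : (E →ₗ[ℝ] ℝ) ≃ₗ[ℝ] (E →L[ℝ] ℝ)).toLinearMap ∘ₗ b)
  exact show Continuous fun x => f x x by fun_prop

/-- A generalized Rayleigh quotient `s / b` attains its maximum on a finite-dimensional space, also
when `b` is degenerate, as long as `s` vanishes on the kernel of `b`: the quotient descends to a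
complement of that kernel, where `b` is definite. -/
lemma exists_rayleigh_max [FiniteDimensional ℝ V] {b s : LinearMap.BilinForm ℝ V}
    (hb : ∀ x, 0 ≤ b x x) (hbsymm : ∀ x y, b x y = b y x)
    (hs : ∀ x, 0 ≤ s x x) (hssymm : ∀ x y, s x y = s y x)
    (hker : ∀ x, b x x = 0 → s x x = 0) {w : V} (hw : 0 < b w w) :
    ∃ w₀, 0 < b w₀ w₀ ∧ ∀ z, s z z * b w₀ w₀ ≤ s w₀ w₀ * b z z := by
  obtain ⟨U, hU⟩ := Submodule.exists_isCompl (LinearMap.ker b)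
  -- `L` parametrizes the complement `U` by coordinates
  let L : (Fin (Module.finrank ℝ U) → ℝ) →ₗ[ℝ] V :=
    U.subtype ∘ₗ (Module.finBasis ℝ U).equivFun.symm.toLinearMap
  have hpos : ∀ x, x ≠ 0 → 0 < b (L x) (L x) := by
    intro x hx
    refine lt_of_le_of_ne (hb _) fun h => hx ?_
    have h1 : L x ∈ LinearMap.ker b :=
      LinearMap.ext fun y => bilin_eq_zero_of_self_eq_zero hb hbsymm h.symm y
    have h2 : L x ∈ U := Subtype.coe_prop _
    have h3 : L x = 0 := by
      have := hU.disjoint.le_bot ⟨h1, h2⟩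
      simpa using this
    have h4 : (Module.finBasis ℝ U).equivFun.symm x = 0 := Subtype.ext h3
    simpa only [map_eq_zero_iff _ (LinearEquiv.injective _)] using h4
  -- `b` and `s` do not see the component in the kernel of `b`
  have hdecomp : ∀ z : V, ∃ x, b z z = b (L x) (L x) ∧ s z z = s (L x) (L x) := by
    intro z
    have hz : z ∈ LinearMap.ker b ⊔ U := by rw [hU.sup_eq_top]; trivial
    obtain ⟨k, hk, u, hu, rfl⟩ := Submodule.mem_sup.1 hz
    refine ⟨(Module.finBasis ℝ U).equivFun ⟨u, hu⟩, ?_⟩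
    have hL : L ((Module.finBasis ℝ U).equivFun ⟨u, hu⟩) = u := by simp [L]
    have hk' : ∀ y, b k y = 0 := fun y => by rw [LinearMap.mem_ker.1 hk]; rfl
    have hks : ∀ y, s k y = 0 := bilin_eq_zero_of_self_eq_zero hs hssymm (hker k (hk' k))
    rw [hL]
    constructor
    · simp [hk', hbsymm u k]
    · simp [hks, hssymm u k]
  have hcont : ∀ f : LinearMap.BilinForm ℝ V, Continuous fun x => f (L x) (L x) := fun f =>
    continuous_bilin_self (f.compl₁₂ L L)
  obtain ⟨x₁, hx₁, -⟩ := hdecomp w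
  have hx₁0 : x₁ ≠ 0 := by
    rintro rfl
    simp [hx₁] at hw
  have hne : (Metric.sphere (0 : Fin (Module.finrank ℝ U) → ℝ) 1).Nonempty :=
    ⟨‖x₁‖⁻¹ • x₁, by
      rw [mem_sphere_zero_iff_norm, norm_smul, norm_inv, norm_norm,
        inv_mul_cancel₀ (norm_ne_zero_iff.2 hx₁0)]⟩
  have hsph : ∀ x ∈ Metric.sphere (0 : Fin (Module.finrank ℝ U) → ℝ) 1, x ≠ 0 := by
    rintro x hx rfl
    simp at hx
  obtain ⟨x₀, hx₀, hmax⟩ := (isCompact_sphere (0 : Fin (Module.finrank ℝ U) → ℝ) 1).exists_isMaxOn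
    hne (f := fun x => s (L x) (L x) / b (L x) (L x))
    ((hcont s).continuousOn.div (hcont b).continuousOn fun x hx => (hpos x (hsph x hx)).ne')
  refine ⟨L x₀, hpos x₀ (hsph x₀ hx₀), fun z => ?_⟩
  obtain ⟨x, hxb, hxs⟩ := hdecomp z
  rw [hxb, hxs]
  rcases eq_or_ne x 0 with rfl | hx
  · simp
  have hnx : 0 < ‖x‖ := norm_pos_iff.2 hx
  have h1 := hmax (show ‖x‖⁻¹ • x ∈ Metric.sphere (0 : Fin (Module.finrank ℝ U) → ℝ) 1 by
    rw [mem_sphere_zero_iff_norm, norm_smul, norm_inv, norm_norm, inv_mul_cancel₀ hnx.ne'])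
  simp only [mem_ofPred_eq, map_smul, LinearMap.smul_apply, smul_eq_mul] at h1
  rw [mul_div_mul_left _ _ (inv_ne_zero hnx.ne'), mul_div_mul_left _ _ (inv_ne_zero hnx.ne'),
    div_le_div_iff₀ (hpos x hx) (hpos x₀ (hsph x₀ hx₀))] at h1
  exact h1

/-- Bessel's inequality for a semidefinite form. -/
lemma bilin_bessel {s : LinearMap.BilinForm ℝ V} (hs : ∀ x, 0 ≤ s x x)
    (hssymm : ∀ x y, s x y = s y x) {n : ℕ} {φ : Fin n → V}
    (horth : ∀ j l, s (φ j) (φ l) = if j = l then 1 else 0) (v : V) :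
    ∑ j, s v (φ j) ^ 2 ≤ s v v := by
  have h := hs (v - ∑ j, s v (φ j) • φ j)
  simp only [map_sub, map_sum, map_smul, LinearMap.sub_apply, LinearMap.sum_apply,
    LinearMap.smul_apply, smul_eq_mul, horth, hssymm _ v, mul_ite, mul_one, mul_zero,
    Finset.sum_ite_eq', Finset.mem_univ, if_true, sub_self, Finset.sum_const_zero, sub_zero] at h
  simp only [sq]
  linarith

/-- The spectral gap estimate `s(v - πv, v - πv) ≤ Λ⁻¹ a(v, v)` for the generalized eigenproblem of
two positive semidefinite forms, where `π` is the projection onto a maximal `s`-orthonormal family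
of eigenvectors with eigenvalue below `Λ`. If it failed, the maximizer of `s / (a + s)` on the
`s`-orthogonal complement of the family would be a further eigenvector. -/
lemma spectral_gap [FiniteDimensional ℝ V] {a s : LinearMap.BilinForm ℝ V}
    (ha : ∀ x, 0 ≤ a x x) (hasymm : ∀ x y, a x y = a y x)
    (hs : ∀ x, 0 ≤ s x x) (hssymm : ∀ x y, s x y = s y x)
    {n : ℕ} {φ : Fin n → V} {ev : Fin n → ℝ} {Λ : ℝ} (hΛ : 0 < Λ)
    (heig : ∀ j w, a (φ j) w = ev j * s (φ j) w)
    (horth : ∀ j l, s (φ j) (φ l) = if j = l then 1 else 0)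
    (hmaximal : ∀ μ < Λ, ∀ w, (∀ z, a w z = μ * s w z) → (∀ j, s w (φ j) = 0) → s w w = 0)
    (v : V) : Λ * (s v v - ∑ j, s v (φ j) ^ 2) ≤ a v v := by
  let W : Submodule ℝ V := ⨅ j, LinearMap.ker (s.flip (φ j))
  have hW : ∀ w, w ∈ W ↔ ∀ j, s w (φ j) = 0 := by
    intro w
    simp [W, Submodule.mem_iInf]
  have hgap : ∀ w ∈ W, Λ * s w w ≤ a w w := by
    by_contra! hcon
    obtain ⟨w, hw, hlt⟩ := hcon
    have hsw : 0 < s w w := by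
      by_contra! h
      nlinarith [ha w, hs w]
    let b : LinearMap.BilinForm ℝ V := a + s
    have hbdef : ∀ x y, b x y = a x y + s x y := fun x y => rfl
    obtain ⟨⟨w₀, hw₀⟩, hpos, hmax⟩ := exists_rayleigh_max (V := W)
      (b := b.compl₁₂ W.subtype W.subtype) (s := s.compl₁₂ W.subtype W.subtype)
      (fun x => by simpa [hbdef] using add_nonneg (ha x) (hs x))
      (fun x y => by simp [hbdef, hasymm x y, hssymm x y])
      (fun x => by simpa using hs x)
      (fun x y => by simp [hssymm x y])
      (fun x hx => by
        have h1 := ha x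
        have h2 := hs x
        simp only [LinearMap.compl₁₂_apply, Submodule.subtype_apply, hbdef] at hx ⊢
        linarith)
      (w := ⟨w, hw⟩) (by simpa [hbdef] using add_pos_of_nonneg_of_pos (ha w) hsw)
    simp only [LinearMap.compl₁₂_apply, Submodule.subtype_apply, Subtype.forall] at hpos hmax
    have hww := hmax w hw
    rw [hbdef] at hpos hww
    rw [hbdef w w] at hww
    have hs0 : 0 < s w₀ w₀ := by
      rcases (hs w₀).lt_or_eq with h | h
      · exact h
      · rw [← h] at hww
        nlinarith [ha w₀]
    -- `q = s(w₀,w₀) b - b(w₀,w₀) s` is semidefinite on `W` and vanishes at `w₀`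
    have hq : ∀ z ∈ W, s w₀ w₀ * b w₀ z = b w₀ w₀ * s w₀ z := by
      intro z hz
      let q : LinearMap.BilinForm ℝ W :=
        (s w₀ w₀ • b - b w₀ w₀ • s).compl₁₂ W.subtype W.subtype
      have hqdef : ∀ x y : W, q x y = s w₀ w₀ * b x y - b w₀ w₀ * s x y := fun x y => rfl
      have := bilin_eq_zero_of_self_eq_zero (b := q)
        (fun x => by
          rw [hqdef]
          linarith [hmax x x.2])
        (fun x y => by simp [hqdef, hbdef, hasymm (x : V) y, hssymm (x : V) y])
        (x := ⟨w₀, hw₀⟩) (by rw [hqdef]; ring) ⟨z, hz⟩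
      rw [hqdef] at this
      linarith
    -- hence `w₀` is an eigenvector on `W`, with an eigenvalue below `Λ`
    let μ : ℝ := a w₀ w₀ / s w₀ w₀
    have hμ : μ < Λ := by
      rw [div_lt_iff₀ hs0]
      nlinarith
    have hw₀j := (hW w₀).1 hw₀
    have hφ : ∀ j, a w₀ (φ j) = 0 := fun j => by
      rw [hasymm, heig, hssymm, hw₀j, mul_zero]
    refine hs0.ne' (hmaximal μ hμ w₀ (fun z => ?_) hw₀j)
    -- split `z` into its projection onto the family and a remainder in `W`
    have hz : z - ∑ j, s z (φ j) • φ j ∈ W := by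
      rw [hW]
      intro l
      simp [horth]
    have h1 := hq _ hz
    have h2 : b w₀ (∑ j, s z (φ j) • φ j) = 0 := by
      simp [hbdef, hφ, hw₀j]
    have h3 : s w₀ (∑ j, s z (φ j) • φ j) = 0 := by
      simp [hw₀j]
    rw [map_sub, map_sub, h2, h3, sub_zero, sub_zero, hbdef, hbdef] at h1
    have h4 : μ * s w₀ z * s w₀ w₀ = a w₀ w₀ * s w₀ z := by
      simp only [μ]
      field_simp
    apply mul_right_cancel₀ hs0.ne'
    linarith
  set p : V := ∑ j, s v (φ j) • φ j with hp
  have hsp : ∀ l, s p (φ l) = s v (φ l) := fun l => by simp [hp, horth]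
  have hvp : v - p ∈ W := by
    rw [hW]
    intro l
    simp [hsp]
  have hspp : s (v - p) p = 0 := by
    have : ∀ q, (∀ j, s q (φ j) = 0) → s q p = 0 := fun q hq => by simp [hp, hq]
    exact this _ ((hW _).1 hvp)
  have happ : a (v - p) p = 0 := by
    have : ∀ q, (∀ j, a q (φ j) = 0) → a q p = 0 := fun q hq => by simp [hp, hq]
    exact this _ fun j => by rw [hasymm, heig, hssymm, (hW _).1 hvp, mul_zero]
  have hpp : s p p = ∑ j, s v (φ j) ^ 2 := by
    conv_lhs => rw [hp, map_sum]
    simp [hp.symm, hsp, sq]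
  have h1 := hgap _ hvp
  have h2 : s v v = s (v - p) (v - p) + s p p := by
    have : s v v = s ((v - p) + p) ((v - p) + p) := by simp
    rw [this, LinearMap.BilinForm.add_left, LinearMap.BilinForm.add_right,
      LinearMap.BilinForm.add_right, hssymm p (v - p), hspp]
    ring
  have h3 : a v v = a (v - p) (v - p) + a p p := by
    have : a v v = a ((v - p) + p) ((v - p) + p) := by simp
    rw [this, LinearMap.BilinForm.add_left, LinearMap.BilinForm.add_right,
      LinearMap.BilinForm.add_right, hasymm p (v - p), happ]
    ring
  rw [h2, h3, hpp]
  linarith [ha p]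

/-- The variational equation of a minimizer of a quadratic functional. -/
lemma bilin_eq_of_minimizer {d : LinearMap.BilinForm ℝ V} (hsymm : ∀ x y, d x y = d y x)
    (c : V →ₗ[ℝ] ℝ) {u : V} (hmin : ∀ v, d u u - 2 * c u ≤ d v v - 2 * c v) (v : V) :
    d u v = c v := by
  have h : ∀ t : ℝ, 0 ≤ d v v * (t * t) + (2 * (d u v - c v)) * t + 0 := by
    intro t
    have := hmin (u + t • v)
    simp only [map_add, map_smul, LinearMap.add_apply, LinearMap.smul_apply, smul_eq_mul,
      hsymm v u] at this
    nlinarith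
  -- the linear term of a nonnegative quadratic polynomial without constant term vanishes
  have := discrim_le_zero h
  simp only [discrim, mul_zero, sub_zero] at this
  nlinarith [sq_nonneg (d u v - c v)]

end LinearAlgebra

/-! ### Affine functions on a simplex -/

section Simplex

variable {r : ℕ}

lemma isCompact_cell (t : Finset (Space r)) : IsCompact (cell t) :=
  t.finite_toSet.isCompact_convexHull ℝ

lemma convex_cell (t : Finset (Space r)) : Convex ℝ (cell t) := convex_convexHull ℝ _

lemma measurableSet_cell (t : Finset (Space r)) : MeasurableSet (cell t) :=
  (isCompact_cell t).measurableSet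

lemma vertex_mem_cell {t : Finset (Space r)} {a : Space r} (ha : a ∈ t) : a ∈ cell t :=
  subset_convexHull ℝ _ ha

lemma interior_cell_ae_eq (t : Finset (Space r)) :
    (interior (cell t) : Set (Space r)) =ᵐ[volume] cell t :=
  interior_ae_eq_of_null_frontier ((convex_cell t).addHaar_frontier volume)

lemma affineSpan_eq_top_of_card {t : Finset (Space r)}
    (ht : AffineIndependent ℝ ((↑) : t → Space r)) (hc : t.card = r + 1) :
    affineSpan ℝ (t : Set (Space r)) = ⊤ := by
  have := ht.affineSpan_eq_top_iff_card_eq_finrank_add_one.2 (by simp [hc])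
  simpa using this

lemma interior_cell_nonempty {t : Finset (Space r)}
    (ht : AffineIndependent ℝ ((↑) : t → Space r)) (hc : t.card = r + 1) :
    (interior (cell t)).Nonempty :=
  interior_convexHull_nonempty_iff_affineSpan_eq_top.2 (affineSpan_eq_top_of_card ht hc)

/-- The affine basis given by the vertices of a full-dimensional simplex. -/
noncomputable def vertexBasis {t : Finset (Space r)}
    (ht : AffineIndependent ℝ ((↑) : t → Space r)) (hc : t.card = r + 1) :
    AffineBasis t ℝ (Space r) :=
  ⟨(↑), ht, by simpa using affineSpan_eq_top_of_card ht hc⟩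

@[simp]
lemma vertexBasis_apply {t : Finset (Space r)}
    (ht : AffineIndependent ℝ ((↑) : t → Space r)) (hc : t.card = r + 1) (a : t) :
    vertexBasis ht hc a = a := rfl

lemma mem_cell_iff_coord_nonneg {t : Finset (Space r)}
    (ht : AffineIndependent ℝ ((↑) : t → Space r)) (hc : t.card = r + 1) {x : Space r} :
    x ∈ cell t ↔ ∀ a, 0 ≤ (vertexBasis ht hc).coord a x := by
  have := (vertexBasis ht hc).convexHull_eq_nonneg_coord
  have hr : range (vertexBasis ht hc) = (t : Set (Space r)) := by
    ext
    simp
  rw [hr] at this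
  rw [cell, this]
  rfl

lemma affineMap_eq_sum_coord {t : Finset (Space r)}
    (ht : AffineIndependent ℝ ((↑) : t → Space r)) (hc : t.card = r + 1)
    (g : Space r →ᵃ[ℝ] ℝ) (x : Space r) :
    g x = ∑ a, (vertexBasis ht hc).coord a x * g a := by
  have h := (vertexBasis ht hc).affineCombination_coord_eq_self x
  conv_lhs => rw [← h]
  rw [Finset.map_affineCombination _ _ _ ((vertexBasis ht hc).sum_coord_apply_eq_one x),
    Finset.affineCombination_eq_linear_combination _ _ _
      ((vertexBasis ht hc).sum_coord_apply_eq_one x)]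
  simp

lemma affineMap_sum_apply {ι : Type*} (L : Finset ι) (h : ι → Space r →ᵃ[ℝ] ℝ) (x : Space r) :
    (∑ l ∈ L, h l) x = ∑ l ∈ L, h l x := by
  classical
  induction L using Finset.induction_on with
  | empty => simp
  | insert a s ha ih => simp [Finset.sum_insert ha, ih]

lemma exists_affineMap_interpolating {t : Finset (Space r)}
    (ht : AffineIndependent ℝ ((↑) : t → Space r)) (hc : t.card = r + 1) (f : Space r → ℝ) :
    ∃ g : Space r →ᵃ[ℝ] ℝ, ∀ a ∈ t, g a = f a := by
  refine ⟨∑ a : t, f a • (vertexBasis ht hc).coord a, fun a ha => ?_⟩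
  rw [affineMap_sum_apply, Finset.sum_eq_single (⟨a, ha⟩ : t)]
  · have := (vertexBasis ht hc).coord_apply_eq ⟨a, ha⟩
    rw [vertexBasis_apply] at this
    simp [this]
  · intro b _ hb
    have := (vertexBasis ht hc).coord_apply_ne hb
    rw [vertexBasis_apply] at this
    simp [this]
  · simp

lemma affineMap_continuous (g : Space r →ᵃ[ℝ] ℝ) : Continuous g :=
  AffineMap.continuous_of_finiteDimensional g

lemma affineMap_le_of_mem_convexHull {s : Set (Space r)} {g : Space r →ᵃ[ℝ] ℝ} {c : ℝ}
    (h : ∀ a ∈ s, g a ≤ c) {x : Space r} (hx : x ∈ convexHull ℝ s) : g x ≤ c :=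
  convexHull_min (t := g ⁻¹' Iic c) h ((convex_Iic c).affine_preimage g) hx

lemma affineMap_eq_of_mem_convexHull {s : Set (Space r)} {g f : Space r →ᵃ[ℝ] ℝ}
    (h : ∀ a ∈ s, g a = f a) {x : Space r} (hx : x ∈ convexHull ℝ s) : g x = f x :=
  AffineMap.eqOn_affineSpan (f := g) (g := f) h (convexHull_subset_affineSpan s hx)

lemma abs_affineMap_le {t : Finset (Space r)} {g : Space r →ᵃ[ℝ] ℝ} {m : ℝ}
    (h : ∀ a ∈ t, |g a| ≤ m) {x : Space r} (hx : x ∈ cell t) : |g x| ≤ m := by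
  have h1 := affineMap_le_of_mem_convexHull (fun a ha => (abs_le.1 (h a ha)).2) hx
  have h2 := affineMap_le_of_mem_convexHull (g := -g) (c := m)
    (fun a ha => by simpa using neg_le.1 (abs_le.1 (h a ha)).1) hx
  rw [abs_le]
  constructor
  · simpa using neg_le.1 h2
  · exact h1

/-- The gradient of an affine function. -/
noncomputable def slope (g : Space r →ᵃ[ℝ] ℝ) : Space r :=
  (InnerProductSpace.toDual ℝ (Space r)).symm (LinearMap.toContinuousLinearMap g.linear)

lemma inner_slope (g : Space r →ᵃ[ℝ] ℝ) (x y : Space r) :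
    inner ℝ (slope g) (y - x) = g y - g x := by
  rw [slope, InnerProductSpace.toDual_symm_apply]
  simpa using g.linearMap_vsub y x

lemma hasGradientAt_affineMap (g : Space r →ᵃ[ℝ] ℝ) (x : Space r) :
    HasGradientAt g (slope g) x := by
  rw [hasGradientAt_iff_hasFDerivAt, slope, LinearIsometryEquiv.apply_symm_apply]
  have h : (g : Space r → ℝ) = fun y => LinearMap.toContinuousLinearMap g.linear y + g 0 := by
    funext y
    have := g.linearMap_vsub y 0
    simp at this ⊢
    linarith
  rw [h]
  exact (ContinuousLinearMap.hasFDerivAt _).add_const _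

lemma gradient_eq_slope {v : Space r → ℝ} {g : Space r →ᵃ[ℝ] ℝ} {t : Finset (Space r)}
    (h : EqOn v g (cell t)) {x : Space r} (hx : x ∈ interior (cell t)) :
    gradient v x = slope g := by
  have he : v =ᶠ[nhds x] g :=
    Filter.eventuallyEq_of_mem (mem_interior_iff_mem_nhds.1 hx) h
  rw [gradient, he.fderiv_eq, ← gradient]
  exact (hasGradientAt_affineMap g x).gradient

lemma abs_affineMap_sub_le (g : Space r →ᵃ[ℝ] ℝ) (x y : Space r) :
    |g x - g y| ≤ ‖slope g‖ * ‖x - y‖ := by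
  rw [← inner_slope]
  exact abs_real_inner_le_norm _ _

/-- An affine function with small oscillation on a simplex has small slope,
measured against the radius of a ball inside the simplex. -/
lemma norm_slope_mul_radius_le {t : Finset (Space r)} {g : Space r →ᵃ[ℝ] ℝ} {B R : ℝ}
    {c : Space r} (hR : 0 < R) (hball : Metric.closedBall c R ⊆ cell t)
    (hB : ∀ a ∈ t, ∀ b ∈ t, |g a - g b| ≤ B) : R * ‖slope g‖ ≤ B := by
  have hosc : ∀ x ∈ cell t, ∀ y ∈ cell t, g x - g y ≤ B := by
    intro x hx y hy
    have h1 : ∀ b ∈ t, g x ≤ B + g b := fun b hb =>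
      affineMap_le_of_mem_convexHull (fun a ha => by linarith [(abs_le.1 (hB a ha b hb)).2]) hx
    have h2 : (-g) y ≤ B - g x := affineMap_le_of_mem_convexHull
      (fun b hb => by simpa using by linarith [h1 b hb]) hy
    have h3 : -g y ≤ B - g x := by simpa using h2
    linarith
  rcases eq_or_ne (slope g) 0 with h0 | h0
  · have hc := hball (Metric.mem_closedBall_self hR.le)
    simpa [h0] using hosc c hc c hc
  have hn : 0 < ‖slope g‖ := norm_pos_iff.2 h0
  -- move from the centre to the boundary of the ball in the direction of steepest ascent
  have hy : c + (R / ‖slope g‖) • slope g ∈ cell t := by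
    apply hball
    rw [Metric.mem_closedBall, dist_eq_norm, add_sub_cancel_left, norm_smul, norm_div, norm_norm,
      div_mul_cancel₀ _ hn.ne', Real.norm_of_nonneg hR.le]
  have h1 := hosc _ hy c (hball (Metric.mem_closedBall_self hR.le))
  rw [← inner_slope, add_sub_cancel_left, inner_smul_right, real_inner_self_eq_norm_sq] at h1
  calc R * ‖slope g‖ = R / ‖slope g‖ * ‖slope g‖ ^ 2 := by field_simp
    _ ≤ B := h1

/-- Stability of the nodal interpolation of a product `f g` on a shape regular simplex. At each node
either the cutoff `f` takes a value in `[0, 1]` or `g` vanishes. -/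
lemma norm_slope_product_le {t : Finset (Space r)} {f g w : Space r →ᵃ[ℝ] ℝ} {σ R m : ℝ}
    {c : Space r} (hR : 0 < R) (hball : Metric.closedBall c R ⊆ cell t)
    (hdiam : Metric.diam (cell t) ≤ σ * R) (hw : ∀ a ∈ t, w a = f a * g a)
    (hf : ∀ a ∈ t, (0 ≤ f a ∧ f a ≤ 1) ∨ g a = 0) (hm : ∀ a ∈ t, |g a| ≤ m) :
    ‖slope w‖ ≤ σ * (‖slope g‖ + ‖slope f‖ * m) := by
  have hdist : ∀ a ∈ t, ∀ b ∈ t, ‖a - b‖ ≤ σ * R := fun a ha b hb => by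
    rw [← dist_eq_norm]
    exact (Metric.dist_le_diam_of_mem (isCompact_cell t).isBounded (vertex_mem_cell ha)
      (vertex_mem_cell hb)).trans hdiam
  suffices h : R * ‖slope w‖ ≤ (‖slope g‖ + ‖slope f‖ * m) * (σ * R) by
    rw [← mul_le_mul_iff_right₀ hR]
    linarith
  refine norm_slope_mul_radius_le hR hball fun a ha b hb => ?_
  have hm0 : 0 ≤ m := (abs_nonneg _).trans (hm a ha)
  have hg : |g a - g b| ≤ ‖slope g‖ * (σ * R) := (abs_affineMap_sub_le g a b).trans
    (mul_le_mul_of_nonneg_left (hdist a ha b hb) (norm_nonneg _))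
  have hff : |f a - f b| ≤ ‖slope f‖ * (σ * R) := (abs_affineMap_sub_le f a b).trans
    (mul_le_mul_of_nonneg_left (hdist a ha b hb) (norm_nonneg _))
  have hsub : |f a - f b| * |g b| ≤ ‖slope f‖ * (σ * R) * m :=
    mul_le_mul hff (hm b hb) (abs_nonneg _) ((abs_nonneg _).trans hff)
  have hnn : 0 ≤ ‖slope f‖ * (σ * R) * m := le_trans (by positivity) hsub
  rw [hw a ha, hw b hb]
  rcases hf a ha with ⟨h0, h1⟩ | h0
  · calc |f a * g a - f b * g b| = |f a * (g a - g b) + (f a - f b) * g b| := by ring_nf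
      _ ≤ |f a| * |g a - g b| + |f a - f b| * |g b| := by
        rw [← abs_mul, ← abs_mul]
        exact abs_add_le _ _
      _ ≤ 1 * (‖slope g‖ * (σ * R)) + ‖slope f‖ * (σ * R) * m := by
        refine add_le_add (mul_le_mul ?_ hg (abs_nonneg _) zero_le_one) hsub
        rwa [abs_of_nonneg h0]
      _ = _ := by ring
  · rcases hf b hb with ⟨h2, h3⟩ | h2
    · rw [h0] at hg ⊢
      calc |f a * 0 - f b * g b| = |f b| * |0 - g b| := by rw [← abs_mul]; ring_nf
        _ ≤ 1 * (‖slope g‖ * (σ * R)) :=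
          mul_le_mul (by rwa [abs_of_nonneg h2]) hg (abs_nonneg _) zero_le_one
        _ ≤ _ := by linarith
    · rw [h0, h2]
      have : 0 ≤ ‖slope g‖ * (σ * R) := (abs_nonneg _).trans hg
      simp only [mul_zero, sub_self, abs_zero]
      linarith

end Simplex

section Weight

variable {r : ℕ} {t : Finset (Space r)} {ρ : Space r → ℝ} {K : ℝ}

lemma volume_interior_cell_ne_top (t : Finset (Space r)) :
    volume (interior (cell t)) ≠ ⊤ :=
  ((measure_mono interior_subset).trans_lt (isCompact_cell t).measure_lt_top).ne

/-- A weight with bounded ratio is integrable on a simplex against every continuous function. -/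
lemma integrableOn_weight_mul (hρ : Measurable ρ) (hpos : ∀ x ∈ interior (cell t), 0 < ρ x)
    (hratio : ∀ x ∈ interior (cell t), ∀ y ∈ interior (cell t), ρ x ≤ K * ρ y)
    {f : Space r → ℝ} (hf : Continuous f) :
    IntegrableOn (fun x => ρ x * f x) (interior (cell t)) := by
  rcases (interior (cell t)).eq_empty_or_nonempty with h | ⟨y, hy⟩
  · simp [h]
  obtain ⟨C, hC⟩ := (isCompact_cell t).exists_bound_of_continuousOn hf.continuousOn
  refine Measure.integrableOn_of_bounded (M := K * ρ y * C) (volume_interior_cell_ne_top t)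
    (hρ.mul hf.measurable).aestronglyMeasurable ?_
  filter_upwards [ae_restrict_mem isOpen_interior.measurableSet] with x hx
  rw [norm_mul]
  have h1 : ‖ρ x‖ ≤ K * ρ y := by
    rw [Real.norm_of_nonneg (hpos x hx).le]
    exact hratio x hx y hy
  exact mul_le_mul h1 (hC x (interior_subset hx)) (norm_nonneg _) ((norm_nonneg _).trans h1)

/-- An affine function is at least half as large as its maximal nodal value on the copy of the
simplex scaled by `1 / 4` towards that node, whence the equivalence of the `L²` norm and the nodal
maximum norm. -/
lemma volume_mul_sq_le_integral_sq {g : Space r →ᵃ[ℝ] ℝ} {a : Space r} (ha : a ∈ t)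
    (hmax : ∀ b ∈ t, |g b| ≤ |g a|) :
    volume.real (cell t) * g a ^ 2 ≤ 4 ^ (r + 1) * ∫ x in cell t, g x ^ 2 := by
  have hsub : AffineMap.homothety a (1 / 4 : ℝ) '' cell t ⊆ cell t := by
    rintro _ ⟨x, hx, rfl⟩
    rw [AffineMap.homothety_eq_lineMap]
    exact (convex_cell t).lineMap_mem (vertex_mem_cell ha) hx ⟨by norm_num, by norm_num⟩
  have hcomp : IsCompact (AffineMap.homothety a (1 / 4 : ℝ) '' cell t) :=
    (isCompact_cell t).image (AffineMap.homothety_continuous a _)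
  have hcont : Continuous fun x => g x ^ 2 := (affineMap_continuous g).pow 2
  have hlow : ∀ x ∈ AffineMap.homothety a (1 / 4 : ℝ) '' cell t, g a ^ 2 / 4 ≤ g x ^ 2 := by
    rintro _ ⟨x, hx, rfl⟩
    have h1 := abs_affineMap_le hmax hx
    have h2 : g (AffineMap.homothety a (1 / 4 : ℝ) x) = g a + (1 / 4) * (g x - g a) := by
      rw [AffineMap.homothety_eq_lineMap, AffineMap.apply_lineMap, AffineMap.lineMap_apply_ring']
      ring
    rw [h2]
    have h3 : g x ^ 2 ≤ g a ^ 2 := sq_le_sq.2 h1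
    have h4 : -(g a ^ 2) ≤ g a * g x := by
      have := neg_abs_le (g a * g x)
      rw [abs_mul] at this
      nlinarith [sq_abs (g a), abs_nonneg (g a)]
    nlinarith [sq_nonneg (g x)]
  have h1 : volume.real (AffineMap.homothety a (1 / 4 : ℝ) '' cell t) * (g a ^ 2 / 4)
      ≤ ∫ x in cell t, g x ^ 2 := by
    calc _ = ∫ _ in AffineMap.homothety a (1 / 4 : ℝ) '' cell t, g a ^ 2 / 4 := by
          rw [setIntegral_const, smul_eq_mul]
      _ ≤ ∫ x in AffineMap.homothety a (1 / 4 : ℝ) '' cell t, g x ^ 2 :=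
        setIntegral_mono_on (integrableOn_const hcomp.measure_lt_top.ne)
          (hcont.continuousOn.integrableOn_compact hcomp) hcomp.measurableSet hlow
      _ ≤ _ := setIntegral_mono_set (hcont.continuousOn.integrableOn_compact (isCompact_cell t))
          (Filter.Eventually.of_forall fun x => sq_nonneg _) hsub.eventuallyLE
  have h2 : volume.real (AffineMap.homothety a (1 / 4 : ℝ) '' cell t)
      = (1 / 4) ^ r * volume.real (cell t) := by
    rw [measureReal_def, Measure.addHaar_image_homothety, ENNReal.toReal_mul, measureReal_def]
    simp
  rw [h2] at h1
  have h4 : (4 : ℝ) ^ (r + 1) * ((1 / 4) ^ r * volume.real (cell t) * (g a ^ 2 / 4))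
      = volume.real (cell t) * g a ^ 2 := by
    rw [one_div, inv_pow]
    field_simp
    ring
  rw [← h4]
  exact mul_le_mul_of_nonneg_left h1 (by positivity)

/-- The weighted `L²` norm of an affine function on a simplex controls its nodal values. -/
lemma integral_weight_mul_sq_le (hind : AffineIndependent ℝ ((↑) : t → Space r))
    (hcard : t.card = r + 1) (hρ : Measurable ρ) (hpos : ∀ x ∈ interior (cell t), 0 < ρ x)
    (hratio : ∀ x ∈ interior (cell t), ∀ y ∈ interior (cell t), ρ x ≤ K * ρ y)
    {g : Space r →ᵃ[ℝ] ℝ} {a : Space r} (ha : a ∈ t) (hmax : ∀ b ∈ t, |g b| ≤ |g a|) :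
    (∫ x in interior (cell t), ρ x) * g a ^ 2
      ≤ 4 ^ (r + 1) * K * ∫ x in interior (cell t), ρ x * g x ^ 2 := by
  have hint := interior_cell_nonempty hind hcard
  have hmeas : MeasurableSet (interior (cell t)) := isOpen_interior.measurableSet
  have hvol : 0 < volume.real (cell t) :=
    ENNReal.toReal_pos ((isOpen_interior.measure_pos volume hint).trans_le
      (measure_mono interior_subset)).ne' (isCompact_cell t).measure_lt_top.ne
  have hvol' : volume.real (interior (cell t)) = volume.real (cell t) :=
    measureReal_congr (interior_cell_ae_eq t)
  have hcont : Continuous fun x => g x ^ 2 := (affineMap_continuous g).pow 2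
  have hρi : IntegrableOn ρ (interior (cell t)) := by
    simpa using integrableOn_weight_mul hρ hpos hratio (continuous_const (y := (1 : ℝ)))
  have hpt : ∀ y ∈ interior (cell t), (∫ x in interior (cell t), ρ x)
      ≤ volume.real (cell t) * (K * ρ y) := by
    intro y hy
    rw [← hvol', ← smul_eq_mul, ← setIntegral_const]
    exact setIntegral_mono_on hρi (integrableOn_const (volume_interior_cell_ne_top t))
      hmeas fun x hx => hratio x hx y hy
  have h1 : (∫ x in interior (cell t), ρ x) * ∫ x in cell t, g x ^ 2
      ≤ volume.real (cell t) * K * ∫ x in interior (cell t), ρ x * g x ^ 2 := by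
    rw [← setIntegral_congr_set (interior_cell_ae_eq t), ← integral_const_mul,
      ← integral_const_mul]
    refine setIntegral_mono_on
      (((hcont.continuousOn.integrableOn_compact (isCompact_cell t)).mono_set
        interior_subset).const_mul _)
      ((integrableOn_weight_mul hρ hpos hratio hcont).const_mul _) hmeas fun x hx => ?_
    calc _ ≤ volume.real (cell t) * (K * ρ x) * g x ^ 2 :=
          mul_le_mul_of_nonneg_right (hpt x hx) (sq_nonneg _)
      _ = _ := by ring
  have h2 := volume_mul_sq_le_integral_sq ha hmax
  have h3 : 0 ≤ ∫ x in interior (cell t), ρ x :=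
    setIntegral_nonneg hmeas fun x hx => (hpos x hx).le
  rw [← mul_le_mul_iff_right₀ hvol]
  calc volume.real (cell t) * ((∫ x in interior (cell t), ρ x) * g a ^ 2)
      = (∫ x in interior (cell t), ρ x) * (volume.real (cell t) * g a ^ 2) := by ring
    _ ≤ (∫ x in interior (cell t), ρ x) * (4 ^ (r + 1) * ∫ x in cell t, g x ^ 2) :=
      mul_le_mul_of_nonneg_left h2 h3
    _ = 4 ^ (r + 1) * ((∫ x in interior (cell t), ρ x) * ∫ x in cell t, g x ^ 2) := by ring
    _ ≤ 4 ^ (r + 1) * (volume.real (cell t) * K * ∫ x in interior (cell t), ρ x * g x ^ 2) :=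
      mul_le_mul_of_nonneg_left h1 (by positivity)
    _ = _ := by ring

end Weight

/-! ### Geometry of the triangulation -/

namespace Triangulation

variable {r : ℕ} (T : Triangulation r) {s t : Finset (Space r)}

lemma finite_elements : T.elements.Finite := T.finite.subset fun _ h => h.1

variable {T}

lemma indep (ht : t ∈ T.elements) : AffineIndependent ℝ ((↑) : t → Space r) :=
  T.complex.indep ht.1

lemma cell_inter_subset (hs : s ∈ T.elements) (ht : t ∈ T.elements) :
    cell s ∩ cell t ⊆ convexHull ℝ (s ∩ t : Set (Space r)) :=
  T.complex.inter_subset_convexHull hs.1 ht.1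

lemma closure_interior_cell (ht : t ∈ T.elements) : closure (interior (cell t)) = cell t := by
  rw [(convex_cell t).closure_interior_eq_closure_of_nonempty_interior
    (interior_cell_nonempty (indep ht) ht.2), (isCompact_cell t).isClosed.closure_eq]

/-- Distinct elements meet in the hull of their common vertices, which has no interior. -/
lemma disjoint_interior_interior (hs : s ∈ T.elements) (ht : t ∈ T.elements) (hne : s ≠ t) :
    Disjoint (interior (cell s)) (interior (cell t)) := by
  rw [Set.disjoint_iff_inter_eq_empty, ← interior_inter]
  by_contra h
  obtain ⟨x, hx⟩ := Set.nonempty_iff_ne_empty.2 h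
  obtain ⟨a, hat, has⟩ : ∃ a ∈ t, a ∉ s := by
    by_contra! hcon
    exact hne (Finset.eq_of_subset_of_card_le hcon (by rw [hs.2, ht.2])).symm
  have h1 : affineSpan ℝ (s ∩ t : Set (Space r)) = ⊤ := by
    have := affineSpan_eq_top_of_nonempty_interior
      ⟨x, interior_mono (cell_inter_subset hs ht) hx⟩
    simpa using this
  have h2 := (indep ht).notMem_affineSpan_sdiff ⟨a, hat⟩ univ
  apply h2
  have h3 : (s ∩ t : Set (Space r)) ⊆ ((↑) : t → Space r) '' (univ \ {⟨a, hat⟩}) := by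
    rintro b ⟨hbs, hbt⟩
    refine ⟨⟨b, hbt⟩, ⟨trivial, ?_⟩, rfl⟩
    rintro h
    have : b = a := congrArg Subtype.val h
    exact has (this ▸ hbs)
  exact affineSpan_mono ℝ h3 (h1 ▸ AffineSubspace.mem_top ℝ _ a)

lemma disjoint_interior_cell (hs : s ∈ T.elements) (ht : t ∈ T.elements) (hne : s ≠ t) :
    Disjoint (interior (cell s)) (cell t) := by
  rw [← closure_interior_cell ht]
  exact (disjoint_interior_interior hs ht hne).closure_right isOpen_interior

lemma space_eq_region : T.complex.space = region T.elements := by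
  ext x
  simp only [Geometry.SimplicialComplex.mem_space_iff, region, mem_iUnion, exists_prop]
  constructor
  · rintro ⟨s, hs, hx⟩
    obtain ⟨t, ht, hst, hc⟩ := T.pure s hs
    exact ⟨t, ⟨ht, hc⟩, convexHull_mono (by exact_mod_cast hst) hx⟩
  · rintro ⟨t, ht, hx⟩
    exact ⟨t, ht.1, hx⟩

lemma domain_subset_region : T.domain ⊆ region T.elements :=
  interior_subset.trans space_eq_region.subset

lemma interior_cell_subset_domain (ht : t ∈ T.elements) : interior (cell t) ⊆ T.domain :=
  interior_mono (T.complex.convexHull_subset_space ht.1)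

/-! ### Integrals over regions -/

lemma region_ae_eq {S : Set (Finset (Space r))} (hS : S ⊆ T.elements) :
    (region S : Set (Space r)) =ᵐ[volume] ⋃ t ∈ S, interior (cell t) :=
  (Filter.EventuallyEq.countable_bUnion (T.finite_elements.subset hS).countable
    fun t _ => interior_cell_ae_eq t).symm

lemma domain_diff_region_ae_eq {S : Set (Finset (Space r))} (hS : S ⊆ T.elements) :
    (T.domain \ region S : Set (Space r)) =ᵐ[volume] ⋃ t ∈ T.elements \ S, interior (cell t) := by
  have h1 : (T.domain : Set (Space r)) =ᵐ[volume] ⋃ t ∈ T.elements, interior (cell t) := by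
    refine Filter.EventuallyLE.antisymm ?_ ?_
    · exact domain_subset_region.eventuallyLE.trans (region_ae_eq Subset.rfl).le
    · exact (iUnion₂_subset fun t ht => interior_cell_subset_domain ht).eventuallyLE
  have h2 : (⋃ t ∈ T.elements, interior (cell t)) \ (⋃ t ∈ S, interior (cell t))
      = ⋃ t ∈ T.elements \ S, interior (cell t) := by
    ext x
    simp only [mem_sdiff, mem_iUnion, exists_prop, not_exists, not_and]
    constructor
    · rintro ⟨⟨t, ht, hx⟩, h⟩
      exact ⟨t, ⟨ht, fun hts => h t hts hx⟩, hx⟩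
    · rintro ⟨t, ⟨ht, hts⟩, hx⟩
      refine ⟨⟨t, ht, hx⟩, fun u hu hxu => ?_⟩
      exact (disjoint_interior_interior ht (hS hu) (by rintro rfl; exact hts hu)).le_bot ⟨hx, hxu⟩
  rw [← h2]
  exact Filter.EventuallyEq.diff h1 (region_ae_eq hS)

open Classical in
lemma integral_iUnion_interior {S : Set (Finset (Space r))} (hS : S ⊆ T.elements)
    {f : Space r → ℝ} (hf : ∀ t ∈ S, IntegrableOn f (interior (cell t))) :
    ∫ x in ⋃ t ∈ S, interior (cell t), f x
      = ∑ t ∈ T.finite_elements.toFinset with t ∈ S, ∫ x in interior (cell t), f x := by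
  have h : (⋃ t ∈ S, interior (cell t))
      = ⋃ t ∈ T.finite_elements.toFinset.filter (· ∈ S), interior (cell t) := by
    ext x
    simp only [mem_iUnion, Finset.mem_filter, Set.Finite.mem_toFinset, exists_prop]
    exact ⟨fun ⟨t, ht, hx⟩ => ⟨t, ⟨hS ht, ht⟩, hx⟩, fun ⟨t, ht, hx⟩ => ⟨t, ht.2, hx⟩⟩
  rw [h]
  refine integral_biUnion_finset _ (fun t _ => isOpen_interior.measurableSet) ?_
    fun t ht => hf t (Finset.mem_filter.1 ht).2
  intro s hs t ht hne
  simp only [Finset.coe_filter, Set.Finite.mem_toFinset, mem_ofPred_eq] at hs ht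
  exact disjoint_interior_interior hs.1 ht.1 hne

/-! ### Nodal interpolation with zero boundary values -/

/-- If some vertex `y` of the face whose relative interior contains `x` lies in the open domain,
then so does `x`: the dilation with centre `y` by a small factor maps a neighbourhood of `x` into
the star of `y`, which fills a neighbourhood of `y`. -/
lemma mem_domain_of_coord_pos (ht : t ∈ T.elements) {x : Space r} (hx : x ∈ cell t) {y : t}
    (hy : (y : Space r) ∈ T.domain) (hpos : 0 < (vertexBasis (indep ht) ht.2).coord y x) :
    x ∈ T.domain := by
  obtain ⟨y, hyt⟩ := y
  simp only at hy
  have hvert : ∀ {u} (hu : u ∈ T.elements) (a b : u), a ≠ b →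
      (vertexBasis (indep hu) hu.2).coord a (b : Space r) = 0 := by
    intro u hu a b hab
    simpa using (vertexBasis (indep hu) hu.2).coord_apply_ne hab
  have hself : ∀ {u} (hu : u ∈ T.elements) (a : u),
      (vertexBasis (indep hu) hu.2).coord a (a : Space r) = 1 := by
    intro u hu a
    simpa using (vertexBasis (indep hu) hu.2).coord_apply_eq a
  -- a point of `t` that also lies in `u` has no weight at the vertices of `t` outside `u`
  have hvanish : ∀ {u}, u ∈ T.elements → ∀ z ∈ cell t, z ∈ cell u → ∀ b : t,
      (b : Space r) ∉ u → (vertexBasis (indep ht) ht.2).coord b z = 0 := by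
    intro u hu z hzt hzu b hb
    refine affineMap_eq_of_mem_convexHull (f := AffineMap.const ℝ _ 0) (fun a ha => ?_)
      (cell_inter_subset ht hu ⟨hzt, hzu⟩)
    exact hvert ht b ⟨a, ha.1⟩ (by rintro rfl; exact hb ha.2)
  -- a dilation with small factor moves the points near `x` outside the mesh to points outside `u`
  have hcell : ∀ u ∈ T.elements, ∀ᶠ ε : ℝ in nhdsWithin 0 (Ioi 0), ∀ᶠ z in nhds x,
      z ∉ region T.elements → AffineMap.lineMap y z ε ∉ cell u := by
    intro u hu
    have hopen : IsOpen (cell u)ᶜ := (isCompact_cell u).isClosed.isOpen_compl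
    have hnear : ∀ ε : ℝ, AffineMap.lineMap y x ε ∉ cell u →
        ∀ᶠ z in nhds x, AffineMap.lineMap y z ε ∉ cell u := by
      intro ε h
      have hc : Continuous fun z : Space r => AffineMap.lineMap y z ε := by
        simp only [AffineMap.lineMap_apply_module]
        fun_prop
      exact hc.continuousAt.eventually_mem (hopen.mem_nhds h)
    by_cases hyu : y ∈ cell u
    · have hyu' : y ∈ u := by
        by_contra h
        have := hvanish hu y (vertex_mem_cell hyt) hyu ⟨y, hyt⟩ h
        rw [hself ht ⟨y, hyt⟩] at this
        exact one_ne_zero this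
      by_cases hxu : x ∈ cell u
      · -- `x` and `y` lie in `u`: a point `z` near `x` outside `u` violates a facet through `y`
        have hcoord : 0 < (vertexBasis (indep hu) hu.2).coord ⟨y, hyu'⟩ x := by
          refine hpos.trans_eq (affineMap_eq_of_mem_convexHull (fun a ha => ?_)
            (cell_inter_subset ht hu ⟨hx, hxu⟩))
          rcases eq_or_ne a y with rfl | hay
          · rw [hself ht ⟨a, hyt⟩, hself hu ⟨a, hyu'⟩]
          · rw [hvert ht ⟨y, hyt⟩ ⟨a, ha.1⟩ (by simpa using hay.symm),
              hvert hu ⟨y, hyu'⟩ ⟨a, ha.2⟩ (by simpa using hay.symm)]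
        filter_upwards [self_mem_nhdsWithin] with ε hε
        filter_upwards [(affineMap_continuous _).continuousAt.eventually_mem
          (isOpen_Ioi.mem_nhds hcoord)] with z hz hzr hzu
        have hzu' : z ∉ cell u := fun h => hzr (mem_iUnion₂.2 ⟨u, hu, h⟩)
        rw [mem_cell_iff_coord_nonneg (indep hu) hu.2] at hzu hzu'
        push Not at hzu'
        obtain ⟨b, hb⟩ := hzu'
        have hby : b ≠ ⟨y, hyu'⟩ := by
          rintro rfl
          exact lt_asymm hb hz
        have h1 := hzu b
        rw [AffineMap.apply_lineMap, hvert hu b ⟨y, hyu'⟩ hby, AffineMap.lineMap_apply_ring'] at h1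
        have : 0 < ε := hε
        nlinarith
      · -- points of the segment from `y` to `x` have the same carrier face as `x`
        filter_upwards [Ioo_mem_nhdsGT zero_lt_one] with ε hε
        refine (hnear ε fun h => hxu ?_).mono fun z hz _ => hz
        have hpt : AffineMap.lineMap y x ε ∈ cell t :=
          (convex_cell t).lineMap_mem (vertex_mem_cell hyt) hx ⟨hε.1.le, hε.2.le⟩
        have hzero : ∀ b : t, (b : Space r) ∉ u →
            (vertexBasis (indep ht) ht.2).coord b x = 0 := by
          intro b hb
          have h1 := hvanish hu _ hpt h b hb
          rw [AffineMap.apply_lineMap, hvert ht b ⟨y, hyt⟩ (by rintro rfl; exact hb hyu'),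
            AffineMap.lineMap_apply_ring'] at h1
          have h2 : ε * (vertexBasis (indep ht) ht.2).coord b x = 0 := by linarith
          exact (mul_eq_zero.1 h2).resolve_left hε.1.ne'
        have hnn := (mem_cell_iff_coord_nonneg (indep ht) ht.2).1 hx
        have hsum := (vertexBasis (indep ht) ht.2).sum_coord_apply_eq_one x
        have hcomb := (vertexBasis (indep ht) ht.2).linear_combination_coord_eq_self x
        classical
        rw [← Finset.sum_filter_of_ne (p := fun b : t => (b : Space r) ∈ u)
          (fun b _ hb => by by_contra h; exact hb (hzero b h))] at hsum
        rw [← Finset.sum_filter_of_ne (p := fun b : t => (b : Space r) ∈ u)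
          (fun b _ hb => by by_contra h; exact hb (by rw [hzero b h, zero_smul]))] at hcomb
        rw [← hcomb]
        exact (convex_cell u).sum_mem (fun b _ => hnn b) hsum
          fun b hb => vertex_mem_cell (Finset.mem_filter.1 hb).2
    · have hc : Continuous fun ε : ℝ => AffineMap.lineMap y x ε := AffineMap.lineMap_continuous
      have h0 : ∀ᶠ ε : ℝ in nhds 0, AffineMap.lineMap y x ε ∈ (cell u)ᶜ :=
        hc.continuousAt.eventually_mem (hopen.mem_nhds (by simpa using hyu))
      exact (h0.filter_mono nhdsWithin_le_nhds).mono fun ε hε =>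
        (hnear ε hε).mono fun z hz _ => hz
  have hc : Continuous fun ε : ℝ => AffineMap.lineMap y x ε := AffineMap.lineMap_continuous
  have h0 : ∀ᶠ ε : ℝ in nhds 0, AffineMap.lineMap y x ε ∈ T.domain :=
    hc.continuousAt.eventually_mem (isOpen_interior.mem_nhds (by simpa [domain] using hy))
  obtain ⟨ε, hε1, hε2⟩ := (((Filter.eventually_all_finite T.finite_elements).2 hcell).and
    (h0.filter_mono nhdsWithin_le_nhds)).exists
  have hc2 : Continuous fun z : Space r => AffineMap.lineMap y z ε := by
    simp only [AffineMap.lineMap_apply_module]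
    fun_prop
  rw [domain, mem_interior_iff_mem_nhds]
  filter_upwards [(Filter.eventually_all_finite T.finite_elements).2 hε1,
    hc2.continuousAt.eventually_mem (isOpen_interior.mem_nhds hε2)] with z hz1 hz2
  rw [space_eq_region]
  by_contra hz
  obtain ⟨u, hu, hzu⟩ := mem_iUnion₂.1 (domain_subset_region hz2)
  exact hz1 u hu hz hzu

/-- Nodal interpolation: every choice of nodal values that vanishes at the nodes on the boundary is
attained by a finite element function. -/
lemma exists_femSpace_interpolating (f : Space r → ℝ)
    (hf : ∀ t ∈ T.elements, ∀ a ∈ t, a ∉ T.domain → f a = 0) :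
    ∃ v ∈ T.femSpace, ∀ t ∈ T.elements, ∀ a ∈ t, v a = f a := by
  classical
  choose! g hg using fun t (ht : t ∈ T.elements) => exists_affineMap_interpolating (indep ht) ht.2 f
  let v : Space r → ℝ := fun x =>
    if h : ∃ t ∈ T.elements, x ∈ cell t then g h.choose x else 0
  -- two interpolants agree on the intersection of their elements, so the choice is immaterial
  have hv : ∀ t ∈ T.elements, EqOn v (g t) (cell t) := by
    intro t ht x hx
    have h : ∃ t ∈ T.elements, x ∈ cell t := ⟨t, ht, hx⟩
    have h1 := h.choose_spec
    simp only [v, dif_pos h]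
    refine affineMap_eq_of_mem_convexHull (fun a ha => ?_)
      (cell_inter_subset h1.1 ht ⟨h1.2, hx⟩)
    rw [hg _ h1.1 a ha.1, hg t ht a ha.2]
  refine ⟨v, ⟨fun t ht => ⟨g t, hv t ht⟩, fun x hx => ?_⟩, fun t ht a ha => ?_⟩
  · by_cases h : ∃ t ∈ T.elements, x ∈ cell t
    · obtain ⟨t, ht, hxt⟩ := h
      rw [hv t ht hxt, affineMap_eq_sum_coord (indep ht) ht.2]
      refine Finset.sum_eq_zero fun a _ => ?_
      rcases ((mem_cell_iff_coord_nonneg (indep ht) ht.2).1 hxt a).eq_or_lt with h0 | h0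
      · rw [← h0, zero_mul]
      · rw [hg t ht a a.2, hf t ht a a.2 fun ha => hx (mem_domain_of_coord_pos ht hxt ha h0),
          mul_zero]
    · simp only [v, dif_neg h]
  · rw [hv t ht (vertex_mem_cell ha), hg t ht a ha]

/-! ### The finite element space -/

variable (T) in
/-- The finite element space `V_h` as a linear subspace of the functions on `ℝ^r`. -/
def femSubmodule : Submodule ℝ (Space r → ℝ) where
  carrier := T.femSpace
  add_mem' := by
    rintro v w ⟨hv, hv0⟩ ⟨hw, hw0⟩
    refine ⟨fun t ht => ?_, fun x hx => by simp [hv0 x hx, hw0 x hx]⟩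
    obtain ⟨g, hg⟩ := hv t ht
    obtain ⟨f, hf⟩ := hw t ht
    exact ⟨g + f, fun x hx => by simp [hg hx, hf hx]⟩
  zero_mem' := ⟨fun t _ => ⟨0, fun x _ => rfl⟩, fun x _ => rfl⟩
  smul_mem' := by
    rintro c v ⟨hv, hv0⟩
    refine ⟨fun t ht => ?_, fun x hx => by simp [hv0 x hx]⟩
    obtain ⟨g, hg⟩ := hv t ht
    exact ⟨c • g, fun x hx => by simp [hg hx]⟩

instance : FiniteDimensional ℝ T.femSubmodule := by
  have hfin : (⋃ t ∈ T.elements, (t : Set (Space r))).Finite :=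
    T.finite_elements.biUnion fun t _ => t.finite_toSet
  have := hfin.to_subtype
  let e : T.femSubmodule →ₗ[ℝ] (↥(⋃ t ∈ T.elements, (t : Set (Space r))) → ℝ) :=
    { toFun := fun v a => (v : Space r → ℝ) a
      map_add' := fun _ _ => rfl
      map_smul' := fun _ _ => rfl }
  refine FiniteDimensional.of_injective e ((injective_iff_map_eq_zero e).2 fun v hv => ?_)
  ext x
  by_cases hx : x ∈ T.domain
  · obtain ⟨t, ht, hxt⟩ := mem_iUnion₂.1 (domain_subset_region hx)
    obtain ⟨g, hg⟩ := v.2.1 t ht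
    rw [hg hxt]
    refine affineMap_eq_of_mem_convexHull (f := AffineMap.const ℝ _ 0) (fun a ha => ?_) hxt
    have := congrFun hv ⟨a, mem_iUnion₂.2 ⟨t, ht, ha⟩⟩
    rw [← hg (vertex_mem_cell ha)]
    exact this
  · exact v.2.2 x hx

end Triangulation

/-! ### The forms `a_i` and `s_i` as sums over elements -/

section ElementIntegrals

variable {r N : ℕ} {t : Finset (Space r)} {ρ : Space r → ℝ} {K : ℝ} {θ : Fin N → Space r → ℝ}
  {v w : Space r → ℝ} {g f : Space r →ᵃ[ℝ] ℝ} {h : Fin N → Space r →ᵃ[ℝ] ℝ}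

@[simp]
lemma slope_add (g f : Space r →ᵃ[ℝ] ℝ) : slope (g + f) = slope g + slope f := by
  simp [slope]

@[simp]
lemma slope_smul (c : ℝ) (g : Space r →ᵃ[ℝ] ℝ) : slope (c • g) = c • slope g := by
  simp [slope]

@[simp]
lemma slope_zero : slope (0 : Space r →ᵃ[ℝ] ℝ) = 0 := by
  simp [slope]

/-- The contribution `∫_τ ρ ∇v · ∇w dx` of one element to the energy. -/
noncomputable def elementEnergy (ρ : Space r → ℝ) (t : Finset (Space r)) (v w : Space r → ℝ) : ℝ :=
  ∫ x in interior (cell t), ρ x * inner ℝ (gradient v x) (gradient w x)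

/-- The contribution `∫_τ ρ ∑_l |∇θ_l|² v w dx` of one element to the weighted mass. -/
noncomputable def elementMass (ρ : Space r → ℝ) (θ : Fin N → Space r → ℝ) (t : Finset (Space r))
    (v w : Space r → ℝ) : ℝ :=
  ∫ x in interior (cell t), ρ x * (∑ l, ‖gradient (θ l) x‖ ^ 2) * v x * w x

lemma energy_eqOn (hv : EqOn v g (cell t)) (hw : EqOn w f (cell t)) :
    EqOn (fun x => ρ x * inner ℝ (gradient v x) (gradient w x))
      (fun x => ρ x * inner ℝ (slope g) (slope f)) (interior (cell t)) := fun x hx => by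
  simp only [gradient_eq_slope hv hx, gradient_eq_slope hw hx]

lemma mass_eqOn (hθ : ∀ l, EqOn (θ l) (h l) (cell t)) (hv : EqOn v g (cell t))
    (hw : EqOn w f (cell t)) :
    EqOn (fun x => ρ x * (∑ l, ‖gradient (θ l) x‖ ^ 2) * v x * w x)
      (fun x => ρ x * ((∑ l, ‖slope (h l)‖ ^ 2) * (g x * f x))) (interior (cell t)) := by
  intro x hx
  simp only [gradient_eq_slope (hθ _) hx, hv (interior_subset hx), hw (interior_subset hx)]
  ring

lemma elementEnergy_eq (hv : EqOn v g (cell t)) (hw : EqOn w f (cell t)) :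
    elementEnergy ρ t v w
      = (∫ x in interior (cell t), ρ x) * inner ℝ (slope g) (slope f) := by
  rw [elementEnergy, setIntegral_congr_fun isOpen_interior.measurableSet (energy_eqOn hv hw),
    integral_mul_const]

lemma elementMass_eq (hθ : ∀ l, EqOn (θ l) (h l) (cell t)) (hv : EqOn v g (cell t))
    (hw : EqOn w f (cell t)) :
    elementMass ρ θ t v w
      = (∑ l, ‖slope (h l)‖ ^ 2) * ∫ x in interior (cell t), ρ x * (g x * f x) := by
  rw [elementMass, setIntegral_congr_fun isOpen_interior.measurableSet (mass_eqOn hθ hv hw),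
    ← integral_const_mul]
  congr 1
  funext x
  ring

end ElementIntegrals

section Forms

variable {r N : ℕ} {T : Triangulation r} {P : Subdomains T N} {ρ : Space r → ℝ} {K : ℝ}
  {θ : Fin N → Space r → ℝ} {t : Finset (Space r)} {i : Fin N} {u v w : Space r → ℝ}

lemma Triangulation.IsCoefficient.integrableOn (hρ : T.IsCoefficient K ρ) (ht : t ∈ T.elements)
    {f : Space r → ℝ} (hf : Continuous f) :
    IntegrableOn (fun x => ρ x * f x) (interior (cell t)) :=
  integrableOn_weight_mul hρ.measurable (hρ.pos t ht) (hρ.ratio t ht) hf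

lemma energy_integrableOn (hρ : T.IsCoefficient K ρ) (hv : T.IsPiecewiseLinear v)
    (hw : T.IsPiecewiseLinear w) (ht : t ∈ T.elements) :
    IntegrableOn (fun x => ρ x * inner ℝ (gradient v x) (gradient w x)) (interior (cell t)) := by
  obtain ⟨g, hg⟩ := hv t ht
  obtain ⟨f, hf⟩ := hw t ht
  exact (hρ.integrableOn ht continuous_const).congr_fun (energy_eqOn hg hf).symm
    isOpen_interior.measurableSet

lemma mass_integrableOn (hρ : T.IsCoefficient K ρ) (hθ : ∀ l, T.IsPiecewiseLinear (θ l))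
    (hv : T.IsPiecewiseLinear v) (hw : T.IsPiecewiseLinear w) (ht : t ∈ T.elements) :
    IntegrableOn (fun x => ρ x * (∑ l, ‖gradient (θ l) x‖ ^ 2) * v x * w x)
      (interior (cell t)) := by
  obtain ⟨g, hg⟩ := hv t ht
  obtain ⟨f, hf⟩ := hw t ht
  choose h hh using fun l => hθ l t ht
  exact (hρ.integrableOn ht (continuous_const.mul
    ((affineMap_continuous g).mul (affineMap_continuous f)))).congr_fun (mass_eqOn hh hg hf).symm
    isOpen_interior.measurableSet

lemma elementEnergy_nonneg (hρ : T.IsCoefficient K ρ) (ht : t ∈ T.elements) :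
    0 ≤ elementEnergy ρ t v v :=
  setIntegral_nonneg isOpen_interior.measurableSet fun x hx =>
    mul_nonneg (hρ.pos t ht x hx).le real_inner_self_nonneg

lemma elementMass_nonneg (hρ : T.IsCoefficient K ρ) (ht : t ∈ T.elements) :
    0 ≤ elementMass ρ θ t v v :=
  setIntegral_nonneg isOpen_interior.measurableSet fun x hx => by
    have h1 := (hρ.pos t ht x hx).le
    rw [mul_assoc]
    exact mul_nonneg (mul_nonneg h1 (Finset.sum_nonneg fun l _ => sq_nonneg _)) (mul_self_nonneg _)

namespace Subdomains

lemma part_subset_elements (P : Subdomains T N) (i : Fin N) : P.part i ⊆ T.elements := by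
  rw [← P.cover]
  exact subset_iUnion _ i

lemma cell_subset_sub (ht : t ∈ P.part i) : cell t ⊆ P.sub i := subset_biUnion_of_mem ht

lemma eq_of_mem_part {l : Fin N} (hi : t ∈ P.part i) (hl : t ∈ P.part l) : i = l := by
  by_contra h
  exact (P.disjoint h).le_bot ⟨hi, hl⟩

open Classical in
lemma aForm_eq_sum (hρ : T.IsCoefficient K ρ) (hv : T.IsPiecewiseLinear v)
    (hw : T.IsPiecewiseLinear w) :
    P.aForm ρ i v w
      = ∑ t ∈ T.finite_elements.toFinset with t ∈ P.part i, elementEnergy ρ t v w := by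
  have hS := P.part_subset_elements i
  rw [aForm, energyForm, sub, setIntegral_congr_set (Triangulation.region_ae_eq hS),
    Triangulation.integral_iUnion_interior hS fun t ht => energy_integrableOn hρ hv hw (hS ht)]
  rfl

lemma gradient_eq_zero_of_notMem_overlapIndices {l : Fin N} (hl : l ∉ P.overlapIndices θ i)
    (ht : t ∈ P.part i) {x : Space r} (hx : x ∈ interior (cell t)) : gradient (θ l) x = 0 := by
  have h0 : EqOn (θ l) (0 : Space r →ᵃ[ℝ] ℝ) (cell t) := by
    intro y hy
    by_contra h
    refine hl ?_
    simp only [overlapIndices, Finset.mem_filter, Finset.mem_univ, true_and]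
    exact ⟨y, h, cell_subset_sub ht hy⟩
  rw [gradient_eq_slope h0 hx, slope_zero]

/-- The restriction of the sum in `s_i` to the indices in `n(i)` drops only zero terms. -/
lemma sum_overlapIndices_eq (ht : t ∈ P.part i) {x : Space r} (hx : x ∈ interior (cell t)) :
    ∑ l ∈ P.overlapIndices θ i, ‖gradient (θ l) x‖ ^ 2 = ∑ l, ‖gradient (θ l) x‖ ^ 2 :=
  Finset.sum_subset (Finset.subset_univ _) fun l _ hl => by
    rw [gradient_eq_zero_of_notMem_overlapIndices hl ht hx, norm_zero, sq, mul_zero]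

open Classical in
lemma sForm_eq_sum (hρ : T.IsCoefficient K ρ) (hθ : ∀ l, T.IsPiecewiseLinear (θ l))
    (hv : T.IsPiecewiseLinear v) (hw : T.IsPiecewiseLinear w) :
    P.sForm ρ θ i v w
      = ∑ t ∈ T.finite_elements.toFinset with t ∈ P.part i, elementMass ρ θ t v w := by
  have hS := P.part_subset_elements i
  have heq : ∀ t ∈ P.part i, EqOn
      (fun x => ρ x * (∑ l ∈ P.overlapIndices θ i, ‖gradient (θ l) x‖ ^ 2) * v x * w x)
      (fun x => ρ x * (∑ l, ‖gradient (θ l) x‖ ^ 2) * v x * w x) (interior (cell t)) :=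
    fun t ht x hx => by simp only [sum_overlapIndices_eq ht hx]
  rw [sForm, sub, setIntegral_congr_set (Triangulation.region_ae_eq hS),
    Triangulation.integral_iUnion_interior hS fun t ht =>
      (mass_integrableOn hρ hθ hv hw (hS ht)).congr_fun (heq t ht).symm
        isOpen_interior.measurableSet]
  exact Finset.sum_congr rfl fun t ht => setIntegral_congr_fun isOpen_interior.measurableSet
    (heq t (Finset.mem_filter.1 ht).2)

lemma aForm_comm (v w : Space r → ℝ) : P.aForm ρ i v w = P.aForm ρ i w v := by
  simp only [aForm, energyForm, real_inner_comm]

lemma sForm_comm (v w : Space r → ℝ) : P.sForm ρ θ i v w = P.sForm ρ θ i w v := by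
  simp only [sForm, mul_assoc, mul_comm (v _)]

lemma aForm_congr_left (h : EqOn u v (P.sub i)) (w : Space r → ℝ) :
    P.aForm ρ i u w = P.aForm ρ i v w := by
  have hS := P.part_subset_elements i
  rw [aForm, aForm, energyForm, energyForm, sub,
    setIntegral_congr_set (Triangulation.region_ae_eq hS),
    setIntegral_congr_set (Triangulation.region_ae_eq hS)]
  refine setIntegral_congr_fun
    (isOpen_biUnion fun t _ => isOpen_interior).measurableSet fun x hx => ?_
  obtain ⟨t, ht, hxt⟩ := mem_iUnion₂.1 hx
  have he : u =ᶠ[nhds x] v := Filter.eventuallyEq_of_mem (mem_interior_iff_mem_nhds.1 hxt)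
    fun y hy => h (cell_subset_sub ht hy)
  simp only [gradient, he.fderiv_eq]

lemma sForm_congr_left (h : EqOn u v (P.sub i)) (w : Space r → ℝ) :
    P.sForm ρ θ i u w = P.sForm ρ θ i v w := by
  have hmeas : MeasurableSet (P.sub i) :=
    .biUnion (T.finite_elements.subset (P.part_subset_elements i)).countable
      fun t _ => measurableSet_cell t
  refine setIntegral_congr_fun hmeas fun x hx => ?_
  simp only [h hx]

variable (P i) in
/-- The form `a_i` on the finite element space. -/
noncomputable def aBilin (hρ : T.IsCoefficient K ρ) : LinearMap.BilinForm ℝ T.femSubmodule :=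
  have hadd : ∀ u v w : T.femSubmodule, P.aForm ρ i (u + v : T.femSubmodule) w
      = P.aForm ρ i u w + P.aForm ρ i v w := fun u v w => by
    classical
    rw [aForm_eq_sum hρ (u + v).2.1 w.2.1, aForm_eq_sum hρ u.2.1 w.2.1,
      aForm_eq_sum hρ v.2.1 w.2.1, ← Finset.sum_add_distrib]
    refine Finset.sum_congr rfl fun t ht => ?_
    have ht' : t ∈ T.elements := by simpa using (Finset.mem_filter.1 ht).1
    obtain ⟨f, hf⟩ := u.2.1 t ht'
    obtain ⟨g, hg⟩ := v.2.1 t ht'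
    obtain ⟨h, hh⟩ := w.2.1 t ht'
    rw [elementEnergy_eq hf hh, elementEnergy_eq hg hh,
      elementEnergy_eq (g := f + g) (fun x hx => by simp [hf hx, hg hx]) hh, slope_add,
      inner_add_left]
    ring
  have hsmul : ∀ (c : ℝ) (v w : T.femSubmodule), P.aForm ρ i (c • v : T.femSubmodule) w
      = c * P.aForm ρ i v w := fun c v w => by
    classical
    rw [aForm_eq_sum hρ (c • v).2.1 w.2.1, aForm_eq_sum hρ v.2.1 w.2.1, Finset.mul_sum]
    refine Finset.sum_congr rfl fun t ht => ?_
    have ht' : t ∈ T.elements := by simpa using (Finset.mem_filter.1 ht).1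
    obtain ⟨g, hg⟩ := v.2.1 t ht'
    obtain ⟨h, hh⟩ := w.2.1 t ht'
    rw [elementEnergy_eq hg hh, elementEnergy_eq (g := c • g) (fun x hx => by simp [hg hx]) hh,
      slope_smul, real_inner_smul_left]
    ring
  LinearMap.mk₂ ℝ (fun v w => P.aForm ρ i v w) hadd hsmul
    (fun u v w => by simp only [aForm_comm (u : Space r → ℝ), hadd])
    (fun c v w => by simp only [aForm_comm (v : Space r → ℝ), hsmul, smul_eq_mul])

@[simp]
lemma aBilin_apply (hρ : T.IsCoefficient K ρ) (v w : T.femSubmodule) :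
    P.aBilin i hρ v w = P.aForm ρ i v w := rfl

variable (P i) in
/-- The form `s_i` on the finite element space. -/
noncomputable def sBilin (hρ : T.IsCoefficient K ρ) (hθ : ∀ l, T.IsPiecewiseLinear (θ l)) :
    LinearMap.BilinForm ℝ T.femSubmodule :=
  have hadd : ∀ u v w : T.femSubmodule, P.sForm ρ θ i (u + v : T.femSubmodule) w
      = P.sForm ρ θ i u w + P.sForm ρ θ i v w := fun u v w => by
    classical
    rw [sForm_eq_sum hρ hθ (u + v).2.1 w.2.1, sForm_eq_sum hρ hθ u.2.1 w.2.1,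
      sForm_eq_sum hρ hθ v.2.1 w.2.1, ← Finset.sum_add_distrib]
    refine Finset.sum_congr rfl fun t ht => ?_
    have ht' : t ∈ T.elements := by simpa using (Finset.mem_filter.1 ht).1
    rw [elementMass, elementMass, elementMass,
      ← integral_add (mass_integrableOn hρ hθ u.2.1 w.2.1 ht')
        (mass_integrableOn hρ hθ v.2.1 w.2.1 ht')]
    congr 1
    funext x
    rw [Submodule.coe_add, Pi.add_apply]
    ring
  have hsmul : ∀ (c : ℝ) (v w : T.femSubmodule), P.sForm ρ θ i (c • v : T.femSubmodule) w
      = c * P.sForm ρ θ i v w := fun c v w => by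
    rw [sForm, sForm, ← integral_const_mul]
    congr 1
    funext x
    rw [Submodule.coe_smul, Pi.smul_apply, smul_eq_mul]
    ring
  LinearMap.mk₂ ℝ (fun v w => P.sForm ρ θ i v w) hadd hsmul
    (fun u v w => by simp only [sForm_comm (u : Space r → ℝ), hadd])
    (fun c v w => by simp only [sForm_comm (v : Space r → ℝ), hsmul, smul_eq_mul])

@[simp]
lemma sBilin_apply (hρ : T.IsCoefficient K ρ) (hθ : ∀ l, T.IsPiecewiseLinear (θ l))
    (v w : T.femSubmodule) : P.sBilin i hρ hθ v w = P.sForm ρ θ i v w := rfl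

lemma aForm_nonneg (hρ : T.IsCoefficient K ρ) (hv : T.IsPiecewiseLinear v) :
    0 ≤ P.aForm ρ i v v := by
  classical
  rw [aForm_eq_sum hρ hv hv]
  exact Finset.sum_nonneg fun t ht => elementEnergy_nonneg hρ
    (by simpa using (Finset.mem_filter.1 ht).1)

lemma sForm_nonneg (hρ : T.IsCoefficient K ρ) (hθ : ∀ l, T.IsPiecewiseLinear (θ l))
    (hv : T.IsPiecewiseLinear v) : 0 ≤ P.sForm ρ θ i v v := by
  classical
  rw [sForm_eq_sum hρ hθ hv hv]
  exact Finset.sum_nonneg fun t ht => elementMass_nonneg hρ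
    (by simpa using (Finset.mem_filter.1 ht).1)

open Classical in
/-- The energy outside a union of subdomains is the sum of the energies of the others. -/
lemma energyForm_domain_diff (hρ : T.IsCoefficient K ρ) (hv : T.IsPiecewiseLinear v)
    (hw : T.IsPiecewiseLinear w) (L : Set (Fin N)) :
    energyForm ρ (T.domain \ ⋃ l ∈ L, P.sub l) v w = ∑ l with l ∉ L, P.aForm ρ l v w := by
  have hreg : (⋃ l ∈ L, P.sub l) = region (⋃ l ∈ L, P.part l) := by
    ext x
    simp only [sub, region, mem_iUnion, exists_prop]
    constructor
    · rintro ⟨l, hl, t, ht, hx⟩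
      exact ⟨t, ⟨l, hl, ht⟩, hx⟩
    · rintro ⟨t, ⟨l, hl, ht⟩, hx⟩
      exact ⟨l, hl, t, ht, hx⟩
  have hS : (⋃ l ∈ L, P.part l) ⊆ T.elements := iUnion₂_subset fun l _ => P.part_subset_elements l
  rw [hreg, energyForm, setIntegral_congr_set (Triangulation.domain_diff_region_ae_eq hS),
    Triangulation.integral_iUnion_interior sdiff_subset fun t ht =>
      energy_integrableOn hρ hv hw ht.1]
  simp only [aForm_eq_sum hρ hv hw, Finset.sum_filter]
  rw [← Finset.sum_filter, Finset.sum_comm]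
  refine Finset.sum_congr rfl fun t ht => ?_
  have ht' : t ∈ T.elements := by simpa using ht
  obtain ⟨p, hp⟩ := mem_iUnion.1 (P.cover.symm ▸ ht' : t ∈ ⋃ i, P.part i)
  have hmem : (t ∈ T.elements \ ⋃ l ∈ L, P.part l) ↔ p ∉ L := by
    simp only [mem_sdiff, ht', true_and, mem_iUnion, exists_prop, not_exists, not_and]
    exact ⟨fun h hpL => h p hpL hp, fun h l hl htl => h (eq_of_mem_part htl hp ▸ hl)⟩
  have hsum : ∀ l, (if t ∈ P.part l then elementEnergy ρ t v w else 0)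
      = if l = p then elementEnergy ρ t v w else 0 := by
    intro l
    congr 1
    exact propext ⟨fun h => eq_of_mem_part h hp, fun h => h ▸ hp⟩
  simp only [hsum, hmem, Finset.sum_ite_eq', Finset.mem_filter, Finset.mem_univ, true_and]
  rfl

lemma energyForm_domain (hρ : T.IsCoefficient K ρ) (hv : T.IsPiecewiseLinear v)
    (hw : T.IsPiecewiseLinear w) : energyForm ρ T.domain v w = ∑ l, P.aForm ρ l v w := by
  classical
  have := energyForm_domain_diff (P := P) hρ hv hw ∅
  simpa using this

end Subdomains

end Forms

/-! ### Stability of the cutoff -/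

section Cutoff

variable {r N : ℕ} {T : Triangulation r} {P : Subdomains T N} {O : Overlap P} {ρ : Space r → ℝ}
  {σ K : ℝ} {M : ℕ} {θ : Fin N → Space r → ℝ} {t : Finset (Space r)} {i : Fin N}
  {v ψ : Space r → ℝ}

lemma slope_sum {ι : Type*} (L : Finset ι) (h : ι → Space r →ᵃ[ℝ] ℝ) :
    slope (∑ l ∈ L, h l) = ∑ l ∈ L, slope (h l) := by
  classical
  induction L using Finset.induction_on with
  | empty => simp
  | insert a s ha ih => simp [Finset.sum_insert ha, ih]

lemma Overlap.ext_subset_elements (O : Overlap P) (l : Fin N) : O.ext l ⊆ T.elements :=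
  (O.subset_layer l).trans (iUnion₂_subset fun p _ => P.part_subset_elements p)

/-- `θ_l` vanishes on the closed elements outside `Ω_l'`, including the points that they share
with `Ω_l'`. -/
lemma Overlap.IsPartitionOfUnity.eq_zero_of_notMem_ext (hθ : O.IsPartitionOfUnity θ)
    (ht : t ∈ T.elements) {l : Fin N} (htl : t ∉ O.ext l) {x : Space r} (hx : x ∈ cell t) :
    θ l x = 0 := by
  obtain ⟨g, hg⟩ := hθ.piecewiseLinear l t ht
  have hint : interior (cell t) ⊆ {y | g y = 0} := by
    intro y hy
    have h0 : θ l y = 0 := by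
      refine hθ.supported l y fun hmem => ?_
      obtain ⟨s, hs, hys⟩ := mem_iUnion₂.1 hmem
      exact (Triangulation.disjoint_interior_cell ht (O.ext_subset_elements l hs)
        (by rintro rfl; exact htl hs)).le_bot ⟨hy, hys⟩
    exact (hg (interior_subset hy)).symm.trans h0
  have hclosed : IsClosed {y | g y = 0} := isClosed_eq (affineMap_continuous g) continuous_const
  rw [hg hx]
  exact hclosed.closure_subset_iff.2 hint ((Triangulation.closure_interior_cell ht).symm ▸ hx)

/-- On an element only `M` of the functions `θ_l` are active, so the gradient of a partial sum is
bounded by the weight of `s_i`. -/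
lemma norm_sum_slope_sq_le (hM : O.MultiplicityLE M) (hθ : O.IsPartitionOfUnity θ)
    (ht : t ∈ T.elements) {h : Fin N → Space r →ᵃ[ℝ] ℝ} (hh : ∀ l, EqOn (θ l) (h l) (cell t))
    (L : Finset (Fin N)) :
    ‖∑ l ∈ L, slope (h l)‖ ^ 2 ≤ M * ∑ l, ‖slope (h l)‖ ^ 2 := by
  classical
  obtain ⟨x, hx⟩ := interior_cell_nonempty (Triangulation.indep ht) ht.2
  have hzero : ∀ l, t ∉ O.ext l → slope (h l) = 0 := by
    intro l hl
    have h0 : EqOn (θ l) (0 : Space r →ᵃ[ℝ] ℝ) (cell t) :=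
      fun y hy => hθ.eq_zero_of_notMem_ext ht hl hy
    rw [← gradient_eq_slope (hh l) hx, gradient_eq_slope h0 hx, slope_zero]
  have hsum : ∑ l ∈ L, slope (h l) = ∑ l ∈ L with t ∈ O.ext l, slope (h l) :=
    (Finset.sum_filter_of_ne fun l _ hl => by by_contra h; exact hl (hzero l h)).symm
  have hcard : ((L.filter fun l => t ∈ O.ext l).card : ℝ) ≤ M := by
    have h1 : (L.filter fun l => t ∈ O.ext l).card ≤ {l | t ∈ O.ext l}.ncard := by
      rw [← Set.ncard_coe_finset]
      exact Set.ncard_le_ncard (fun l hl => (Finset.mem_filter.1 hl).2) (Set.toFinite _)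
    exact_mod_cast h1.trans (hM t ht)
  calc ‖∑ l ∈ L, slope (h l)‖ ^ 2 ≤ (∑ l ∈ L with t ∈ O.ext l, ‖slope (h l)‖) ^ 2 := by
        rw [hsum]
        exact pow_le_pow_left₀ (norm_nonneg _) (norm_sum_le _ _) 2
    _ ≤ (L.filter fun l => t ∈ O.ext l).card * ∑ l ∈ L with t ∈ O.ext l, ‖slope (h l)‖ ^ 2 :=
        sq_sum_le_card_mul_sum_sq
    _ ≤ M * ∑ l, ‖slope (h l)‖ ^ 2 := by
        refine mul_le_mul hcard ?_ (Finset.sum_nonneg fun _ _ => sq_nonneg _) (Nat.cast_nonneg _)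
        exact Finset.sum_le_univ_sum_of_nonneg fun _ => sq_nonneg _

/-- At the nodes inside the domain, partial sums of the partition of unity lie in `[0, 1]`; at nodes
on `∂Ω` this may fail. -/
lemma sum_theta_mem_Icc (hθ : O.IsPartitionOfUnity θ) (ht : t ∈ T.elements) {a : Space r}
    (ha : a ∈ t) (had : a ∈ T.domain) (L : Finset (Fin N)) :
    ∑ l ∈ L, θ l a ∈ Icc (0 : ℝ) 1 := by
  refine ⟨Finset.sum_nonneg fun l _ => hθ.nonneg l a, ?_⟩
  rw [← hθ.sum_eq_one a (T.complex.down_closed ht.1 (Finset.singleton_subset_iff.2 ha)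
    (Finset.singleton_nonempty a)) had]
  exact Finset.sum_le_univ_sum_of_nonneg fun l => hθ.nonneg l a

/-- Stability on one element of the multiplication by the cutoff `1 - ∑_{l ∈ L} θ_l` followed by
nodal interpolation. -/
lemma element_cutoff_le (hσ : T.ShapeRegular σ) (hρ : T.IsCoefficient K ρ)
    (hM : O.MultiplicityLE M) (hθ : O.IsPartitionOfUnity θ) (L : Finset (Fin N))
    (hψ : ψ ∈ T.femSpace) (hv : v ∈ T.femSpace) (ht : t ∈ T.elements)
    (hnode : ∀ a ∈ t, v a = (1 - ∑ l ∈ L, θ l a) * ψ a) :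
    elementEnergy ρ t v v ≤ 2 * σ ^ 2 * elementEnergy ρ t ψ ψ
      + 2 * σ ^ 2 * M * (4 ^ (r + 1) * |K|) * elementMass ρ θ t ψ ψ ∧
    elementMass ρ θ t v v ≤ 4 ^ (r + 1) * |K| * elementMass ρ θ t ψ ψ := by
  obtain ⟨c, R, hR, hball, hdiam⟩ := hσ t ht
  obtain ⟨g, hg⟩ := hψ.1 t ht
  obtain ⟨w, hw⟩ := hv.1 t ht
  choose h hh using fun l => hθ.piecewiseLinear l t ht
  have hne : t.Nonempty := Finset.card_pos.1 (by rw [ht.2]; omega)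
  -- the node where `|ψ|` is largest
  obtain ⟨a, hat, hmax⟩ := t.exists_max_image (fun b => |g b|) hne
  set f : Space r →ᵃ[ℝ] ℝ := AffineMap.const ℝ (Space r) (1 : ℝ) - ∑ l ∈ L, h l with hfdef
  have hf : ∀ b ∈ t, f b = 1 - ∑ l ∈ L, θ l b := by
    intro b hb
    simp [hfdef, affineMap_sum_apply, fun l => hh l (vertex_mem_cell hb)]
  have hfslope : ‖slope f‖ ^ 2 ≤ M * ∑ l, ‖slope (h l)‖ ^ 2 := by
    have h1 : slope f = -∑ l ∈ L, slope (h l) := by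
      rw [← slope_sum]
      simp [hfdef, slope]
    rw [h1, norm_neg]
    exact norm_sum_slope_sq_le hM hθ ht hh L
  have hprod : ∀ b ∈ t, w b = f b * g b := fun b hb => by
    rw [← hw (vertex_mem_cell hb), ← hg (vertex_mem_cell hb), hf b hb, hnode b hb]
  have hcut : ∀ b ∈ t, (0 ≤ f b ∧ f b ≤ 1) ∨ g b = 0 := by
    intro b hb
    by_cases hbd : b ∈ T.domain
    · have := sum_theta_mem_Icc hθ ht hb hbd L
      rw [hf b hb]
      exact Or.inl ⟨by linarith [this.2], by linarith [this.1]⟩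
    · exact Or.inr (by rw [← hg (vertex_mem_cell hb), hψ.2 b hbd])
  have hwle : ∀ b ∈ t, |w b| ≤ |g a| := by
    intro b hb
    rw [hprod b hb, abs_mul]
    rcases hcut b hb with ⟨h0, h1⟩ | h0
    · rw [abs_of_nonneg h0]
      exact (mul_le_of_le_one_left (abs_nonneg _) h1).trans (hmax b hb)
    · simp [h0]
  have hslope := norm_slope_product_le hR hball hdiam hprod hcut hmax
  have hmass := integral_weight_mul_sq_le (Triangulation.indep ht) ht.2 hρ.measurable
    (hρ.pos t ht) (hρ.ratio t ht) hat hmax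
  have hmeas : MeasurableSet (interior (cell t)) := isOpen_interior.measurableSet
  have hρ0 : 0 ≤ ∫ x in interior (cell t), ρ x :=
    setIntegral_nonneg hmeas fun x hx => (hρ.pos t ht x hx).le
  have hg0 : 0 ≤ ∫ x in interior (cell t), ρ x * g x ^ 2 :=
    setIntegral_nonneg hmeas fun x hx => mul_nonneg (hρ.pos t ht x hx).le (sq_nonneg _)
  have hmass' : (∫ x in interior (cell t), ρ x) * g a ^ 2
      ≤ 4 ^ (r + 1) * |K| * ∫ x in interior (cell t), ρ x * g x ^ 2 :=
    hmass.trans (by gcongr; exact le_abs_self K)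
  have hw2 : ∫ x in interior (cell t), ρ x * w x ^ 2
      ≤ (∫ x in interior (cell t), ρ x) * g a ^ 2 := by
    rw [← integral_mul_const]
    refine setIntegral_mono_on (hρ.integrableOn ht ((affineMap_continuous w).pow 2))
      (hρ.integrableOn ht continuous_const) hmeas fun x hx => ?_
    exact mul_le_mul_of_nonneg_left
      (sq_le_sq.2 (abs_affineMap_le hwle (interior_subset hx))) (hρ.pos t ht x hx).le
  set Θ : ℝ := ∑ l, ‖slope (h l)‖ ^ 2 with hΘ
  have hΘ0 : 0 ≤ Θ := Finset.sum_nonneg fun _ _ => sq_nonneg _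
  rw [elementEnergy_eq hw hw, elementEnergy_eq hg hg, elementMass_eq hh hw hw,
    elementMass_eq hh hg hg]
  simp only [real_inner_self_eq_norm_sq, ← sq, ← hΘ]
  constructor
  · have h1 : ‖slope w‖ ^ 2 ≤ 2 * σ ^ 2 * ‖slope g‖ ^ 2 + 2 * σ ^ 2 * (M * Θ) * g a ^ 2 := by
      calc ‖slope w‖ ^ 2 ≤ (σ * (‖slope g‖ + ‖slope f‖ * |g a|)) ^ 2 :=
            pow_le_pow_left₀ (norm_nonneg _) hslope 2
        _ = σ ^ 2 * (‖slope g‖ + ‖slope f‖ * |g a|) ^ 2 := by ring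
        _ ≤ σ ^ 2 * (2 * (‖slope g‖ ^ 2 + (‖slope f‖ * |g a|) ^ 2)) :=
            mul_le_mul_of_nonneg_left add_sq_le (sq_nonneg _)
        _ = 2 * σ ^ 2 * ‖slope g‖ ^ 2 + 2 * σ ^ 2 * ‖slope f‖ ^ 2 * g a ^ 2 := by
            rw [mul_pow, sq_abs]
            ring
        _ ≤ _ := by gcongr
    calc _ ≤ (∫ x in interior (cell t), ρ x)
          * (2 * σ ^ 2 * ‖slope g‖ ^ 2 + 2 * σ ^ 2 * (M * Θ) * g a ^ 2) :=
          mul_le_mul_of_nonneg_left h1 hρ0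
      _ = 2 * σ ^ 2 * ((∫ x in interior (cell t), ρ x) * ‖slope g‖ ^ 2)
          + 2 * σ ^ 2 * M * Θ * ((∫ x in interior (cell t), ρ x) * g a ^ 2) := by ring
      _ ≤ 2 * σ ^ 2 * ((∫ x in interior (cell t), ρ x) * ‖slope g‖ ^ 2)
          + 2 * σ ^ 2 * M * Θ
            * (4 ^ (r + 1) * |K| * ∫ x in interior (cell t), ρ x * g x ^ 2) := by gcongr
      _ = _ := by ring
  · calc _ ≤ Θ * (4 ^ (r + 1) * |K| * ∫ x in interior (cell t), ρ x * g x ^ 2) :=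
          mul_le_mul_of_nonneg_left (hw2.trans hmass') hΘ0
      _ = _ := by ring

/-- The stability constant of the cutoff, which depends on the dimension, the shape regularity, the
coefficient ratio and the overlap multiplicity only. The summand `1` makes it at least one. -/
noncomputable def cutoffConstant (r : ℕ) (σ K : ℝ) (M : ℕ) : ℝ :=
  2 * σ ^ 2 + (2 * σ ^ 2 * M + 1) * (4 ^ (r + 1) * |K|) + 1

lemma one_le_cutoffConstant (r : ℕ) (σ K : ℝ) (M : ℕ) : 1 ≤ cutoffConstant r σ K M := by
  rw [cutoffConstant]
  exact le_add_of_nonneg_left (by positivity)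

/-- Stability of the cutoff on a subdomain. -/
lemma subdomain_cutoff_le (hσ : T.ShapeRegular σ) (hρ : T.IsCoefficient K ρ)
    (hM : O.MultiplicityLE M) (hθ : O.IsPartitionOfUnity θ) (L : Finset (Fin N))
    (hψ : ψ ∈ T.femSpace) (hv : v ∈ T.femSpace)
    (hnode : ∀ t ∈ T.elements, ∀ a ∈ t, v a = (1 - ∑ l ∈ L, θ l a) * ψ a) (i : Fin N) :
    P.aForm ρ i v v + P.sForm ρ θ i v v
      ≤ cutoffConstant r σ K M * (P.aForm ρ i ψ ψ + P.sForm ρ θ i ψ ψ) := by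
  classical
  rw [Subdomains.aForm_eq_sum hρ hv.1 hv.1, Subdomains.aForm_eq_sum hρ hψ.1 hψ.1,
    Subdomains.sForm_eq_sum hρ hθ.piecewiseLinear hv.1 hv.1,
    Subdomains.sForm_eq_sum hρ hθ.piecewiseLinear hψ.1 hψ.1, ← Finset.sum_add_distrib,
    ← Finset.sum_add_distrib, Finset.mul_sum]
  refine Finset.sum_le_sum fun t ht => ?_
  have ht' : t ∈ T.elements := by simpa using (Finset.mem_filter.1 ht).1
  obtain ⟨h1, h2⟩ := element_cutoff_le hσ hρ hM hθ L hψ hv ht' (hnode t ht')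
  have ha : 0 ≤ elementEnergy ρ t ψ ψ := elementEnergy_nonneg hρ ht'
  have hs : 0 ≤ elementMass ρ θ t ψ ψ := elementMass_nonneg hρ ht'
  have h3 : 0 ≤ (2 * σ ^ 2 * M + 1) * (4 ^ (r + 1) * |K|) * elementEnergy ρ t ψ ψ := by positivity
  have h4 : 0 ≤ 2 * σ ^ 2 * elementMass ρ θ t ψ ψ := by positivity
  rw [cutoffConstant]
  linarith

end Cutoff

/-! ### Layers of subdomains -/

section Layers

variable {r N : ℕ} {T : Triangulation r} {P : Subdomains T N} {O : Overlap P}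
  {θ : Fin N → Space r → ℝ} {t : Finset (Space r)} {i : Fin N} {v ψ : Space r → ℝ}

lemma Subdomains.layers_subset_succ (P : Subdomains T N) (i : Fin N) (k : ℕ) :
    P.layers i k ⊆ P.layers i (k + 1) := fun l hl =>
  ⟨l, hl, (inter_self (P.sub l)).symm ▸ (P.connected l).nonempty⟩

lemma Subdomains.layers_mono (P : Subdomains T N) (i : Fin N) : Monotone (P.layers i) :=
  monotone_nat_of_le_succ (P.layers_subset_succ i)

/-- If `θ_l` is active on an element of `Ω_p` then `Ω_p` and `Ω_l` touch. -/
lemma Overlap.IsPartitionOfUnity.touch_of_ne_zero (hθ : O.IsPartitionOfUnity θ) {p l : Fin N}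
    (ht : t ∈ P.part p) {x : Space r} (hx : x ∈ cell t) (hne : θ l x ≠ 0) :
    (P.sub p ∩ P.sub l).Nonempty := by
  have htl : t ∈ O.ext l := by
    by_contra h
    exact hne (hθ.eq_zero_of_notMem_ext (P.part_subset_elements p ht) h hx)
  obtain ⟨q, ⟨l', hl', hq⟩, htq⟩ := mem_iUnion₂.1 (O.subset_layer l htl)
  rw [Subdomains.eq_of_mem_part ht htq]
  rwa [show l' = l from hl'] at hq

lemma eqOn_sub_of_nodes {p : Fin N} (hv : v ∈ T.femSpace) (hψ : ψ ∈ T.femSpace)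
    (h : ∀ t ∈ P.part p, ∀ a ∈ t, v a = ψ a) : EqOn v ψ (P.sub p) := by
  intro x hx
  obtain ⟨t, ht, hxt⟩ := mem_iUnion₂.1 hx
  obtain ⟨g, hg⟩ := hv.1 t (P.part_subset_elements p ht)
  obtain ⟨f, hf⟩ := hψ.1 t (P.part_subset_elements p ht)
  rw [hg hxt, hf hxt]
  refine affineMap_eq_of_mem_convexHull (fun a ha => ?_) hxt
  rw [← hg (vertex_mem_cell ha), ← hf (vertex_mem_cell ha), h t ht a ha]

open Classical in
/-- The function with nodal values `(1 - ∑ θ_l) ψ`, where `l` runs through `Ω_{i,k+1}`, vanishes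
on `Ω_{i,k}` and coincides with `ψ` outside `Ω_{i,k+2}`. -/
lemma cutoff_eqOn (hθ : O.IsPartitionOfUnity θ) (i : Fin N) (k : ℕ)
    (hψ : ψ ∈ T.femSpace) (hv : v ∈ T.femSpace)
    (hnode : ∀ t ∈ T.elements, ∀ a ∈ t,
      v a = (1 - ∑ l with l ∈ P.layers i (k + 1), θ l a) * ψ a) (p : Fin N) :
    (p ∈ P.layers i k → EqOn v 0 (P.sub p)) ∧
      (p ∉ P.layers i (k + 2) → EqOn v ψ (P.sub p)) := by
  constructor
  · intro hp
    refine eqOn_sub_of_nodes hv T.femSubmodule.zero_mem fun t ht a ha => ?_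
    have ht' := P.part_subset_elements p ht
    rw [hnode t ht' a ha, Pi.zero_apply]
    by_cases had : a ∈ T.domain
    · have h1 : ∑ l with l ∈ P.layers i (k + 1), θ l a = ∑ l, θ l a := by
        refine Finset.sum_filter_of_ne fun l _ hl => ?_
        have := hθ.touch_of_ne_zero ht (vertex_mem_cell ha) hl
        exact ⟨p, hp, by rwa [inter_comm]⟩
      rw [h1, hθ.sum_eq_one a (T.complex.down_closed ht'.1 (Finset.singleton_subset_iff.2 ha)
        (Finset.singleton_nonempty a)) had, sub_self, zero_mul]
    · rw [hψ.2 a had, mul_zero]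
  · intro hp
    refine eqOn_sub_of_nodes hv hψ fun t ht a ha => ?_
    have h1 : ∑ l with l ∈ P.layers i (k + 1), θ l a = 0 := by
      refine Finset.sum_eq_zero fun l hl => ?_
      by_contra h
      exact hp ⟨l, (Finset.mem_filter.1 hl).2, hθ.touch_of_ne_zero ht (vertex_mem_cell ha) h⟩
    rw [hnode t (P.part_subset_elements p ht) a ha, h1, sub_zero, one_mul]

end Layers

/-! ### Energy decay of the global basis functions -/

namespace Subdomains

namespace AuxiliaryBasis

variable {r N : ℕ} {T : Triangulation r} {P : Subdomains T N} {O : Overlap P} {ρ : Space r → ℝ}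
  {σ K Λ : ℝ} {M : ℕ} {θ : Fin N → Space r → ℝ} {i : Fin N}

/-- A finite element function whose restriction to `Ω_k` is the eigenfunction `φ_j^{(k)}`. -/
noncomputable def lift (B : P.AuxiliaryBasis ρ θ Λ) (k : Fin N) (j : Fin (B.num k)) :
    T.femSubmodule :=
  ⟨(B.mem k j).choose, (B.mem k j).choose_spec.1⟩

lemma eqOn_lift (B : P.AuxiliaryBasis ρ θ Λ) (k : Fin N) (j : Fin (B.num k)) :
    EqOn (B.fn k j) (B.lift k j) (P.sub k) := fun x hx => by
  rw [← (B.mem k j).choose_spec.2]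
  exact indicator_of_mem hx _

variable (hρ : T.IsCoefficient K ρ) (hθ : ∀ l, T.IsPiecewiseLinear (θ l))

/-- The coefficient `s_k(v, φ_j^{(k)})` of `π_k v`, as a linear functional of `v ∈ V_h`. -/
noncomputable def coeff (B : P.AuxiliaryBasis ρ θ Λ) (k : Fin N) (j : Fin (B.num k)) :
    T.femSubmodule →ₗ[ℝ] ℝ :=
  (P.sBilin k hρ hθ).flip (B.lift k j)

lemma coeff_apply (B : P.AuxiliaryBasis ρ θ Λ) (k : Fin N) (j : Fin (B.num k))
    (v : T.femSubmodule) : B.coeff hρ hθ k j v = P.sForm ρ θ k v (B.fn k j) := by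
  rw [sForm_comm, sForm_congr_left (B.eqOn_lift k j), sForm_comm]
  rfl

lemma lift_orthonormal (B : P.AuxiliaryBasis ρ θ Λ) (k : Fin N) (j l : Fin (B.num k)) :
    P.sBilin k hρ hθ (B.lift k j) (B.lift k l) = if j = l then 1 else 0 := by
  rw [← B.orthonormal k j l, sForm_congr_left (B.eqOn_lift k j), sForm_comm,
    sForm_congr_left (B.eqOn_lift k l), sForm_comm, sBilin_apply]

/-- Pythagoras: the `s_k`-norm of a combination of the eigenfunctions. -/
lemma sForm_combination (hρ : T.IsCoefficient K ρ) (hθ : ∀ l, T.IsPiecewiseLinear (θ l))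
    (B : P.AuxiliaryBasis ρ θ Λ) (k : Fin N) (c : Fin (B.num k) → ℝ) {u : Space r → ℝ}
    (hu : ∀ x, u x = ∑ j, c j * B.fn k j x) :
    P.sForm ρ θ k u u = ∑ j, c j ^ 2 := by
  have h : EqOn u (∑ j, c j • B.lift k j : T.femSubmodule) (P.sub k) := by
    intro x hx
    rw [hu x, AddSubmonoidClass.coe_finsetSum, Finset.sum_apply]
    exact Finset.sum_congr rfl fun j _ => by rw [B.eqOn_lift k j hx]; rfl
  rw [sForm_congr_left h, sForm_comm, sForm_congr_left h, ← sBilin_apply hρ hθ]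
  simp only [map_sum, map_smul, LinearMap.sum_apply, LinearMap.smul_apply, smul_eq_mul,
    B.lift_orthonormal hρ hθ, mul_ite, mul_one, mul_zero, Finset.sum_ite_eq', Finset.mem_univ,
    if_true, sq]

lemma projNormSq_eq (B : P.AuxiliaryBasis ρ θ Λ) (k : Fin N) (v : T.femSubmodule) :
    B.projNormSq k v = ∑ j, B.coeff hρ hθ k j v ^ 2 :=
  sForm_combination hρ hθ B k (fun j => B.coeff hρ hθ k j v) fun x => by
    simp only [proj, coeff_apply]

/-- The contribution `a_k(v, w) + s_k(π_k v, π_k w)` of `Ω_k` to the form whose quadratic part is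
the total energy. -/
noncomputable def localForm (B : P.AuxiliaryBasis ρ θ Λ) (k : Fin N) :
    LinearMap.BilinForm ℝ T.femSubmodule :=
  P.aBilin k hρ
    + ∑ j, LinearMap.BilinForm.linMulLin (B.coeff hρ hθ k j) (B.coeff hρ hθ k j)

lemma localForm_apply (B : P.AuxiliaryBasis ρ θ Λ) (k : Fin N) (v w : T.femSubmodule) :
    B.localForm hρ hθ k v w
      = P.aForm ρ k v w + ∑ j, B.coeff hρ hθ k j v * B.coeff hρ hθ k j w := by
  simp [localForm, LinearMap.sum_apply]

lemma localForm_self (B : P.AuxiliaryBasis ρ θ Λ) (k : Fin N) (v : T.femSubmodule) :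
    B.localForm hρ hθ k v v = P.aForm ρ k v v + B.projNormSq k v := by
  rw [localForm_apply, B.projNormSq_eq hρ hθ]
  simp only [sq]

lemma localForm_comm (B : P.AuxiliaryBasis ρ θ Λ) (k : Fin N) (v w : T.femSubmodule) :
    B.localForm hρ hθ k v w = B.localForm hρ hθ k w v := by
  rw [localForm_apply, localForm_apply, aForm_comm]
  simp only [mul_comm]

lemma localForm_nonneg (B : P.AuxiliaryBasis ρ θ Λ) (k : Fin N) (v : T.femSubmodule) :
    0 ≤ B.localForm hρ hθ k v v := by
  rw [localForm_self, B.projNormSq_eq hρ hθ]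
  exact add_nonneg (aForm_nonneg hρ v.2.1) (Finset.sum_nonneg fun _ _ => sq_nonneg _)

lemma localForm_congr_right (B : P.AuxiliaryBasis ρ θ Λ) (k : Fin N) (u : T.femSubmodule)
    {v w : T.femSubmodule} (h : EqOn (v : Space r → ℝ) w (P.sub k)) :
    B.localForm hρ hθ k u v = B.localForm hρ hθ k u w := by
  simp only [localForm_apply, coeff_apply, sForm_congr_left h]
  rw [aForm_comm, aForm_congr_left h, aForm_comm]

/-- The local form is bounded by `a_k + s_k`, by Bessel's inequality. -/
lemma localForm_self_le (B : P.AuxiliaryBasis ρ θ Λ) (k : Fin N) (v : T.femSubmodule) :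
    B.localForm hρ hθ k v v ≤ P.aForm ρ k v v + P.sForm ρ θ k v v := by
  rw [localForm_self, B.projNormSq_eq hρ hθ]
  exact add_le_add_right (bilin_bessel (fun u => sForm_nonneg hρ hθ u.2.1)
    (fun u w => sForm_comm _ _) (B.lift_orthonormal hρ hθ k) v) _

/-- Since the functions `φ_j^{(k)}` exhaust the eigenvalues below `Λ`, the part of `v` missed by
`π_k` is controlled by the energy, and the local form controls `a_k + s_k`. -/
lemma aForm_add_sForm_le (B : P.AuxiliaryBasis ρ θ Λ) (hΛ : 0 < Λ) (k : Fin N)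
    (v : T.femSubmodule) :
    P.aForm ρ k v v + P.sForm ρ θ k v v ≤ (1 + Λ⁻¹) * B.localForm hρ hθ k v v := by
  have hind : ∀ w : T.femSubmodule, EqOn ((P.sub k).indicator (w : Space r → ℝ)) w (P.sub k) :=
    fun w x hx => indicator_of_mem hx _
  have hmem : ∀ w : T.femSubmodule, (P.sub k).indicator (w : Space r → ℝ) ∈ P.localSpace k :=
    fun w => ⟨w, w.2, rfl⟩
  have haind : ∀ (u : Space r → ℝ) (w : T.femSubmodule),
      P.aForm ρ k u ((P.sub k).indicator (w : Space r → ℝ)) = P.aForm ρ k u w := fun u w => by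
    rw [aForm_comm, aForm_congr_left (hind w), aForm_comm]
  have hsind : ∀ (u : Space r → ℝ) (w : T.femSubmodule),
      P.sForm ρ θ k u ((P.sub k).indicator (w : Space r → ℝ)) = P.sForm ρ θ k u w := fun u w => by
    rw [sForm_comm, sForm_congr_left (hind w), sForm_comm]
  have hgap := spectral_gap (a := P.aBilin k hρ) (s := P.sBilin k hρ hθ)
    (fun u => aForm_nonneg hρ u.2.1) (fun u w => aForm_comm _ _)
    (fun u => sForm_nonneg hρ hθ u.2.1) (fun u w => sForm_comm _ _) hΛ
    (φ := B.lift k) (ev := B.eigenvalue k)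
    (fun j w => by
      have := B.eigen k j _ (hmem w)
      rwa [haind, hsind, aForm_congr_left (B.eqOn_lift k j),
        sForm_congr_left (B.eqOn_lift k j)] at this)
    (B.lift_orthonormal hρ hθ k)
    (fun μ hμ w hw horth => by
      have := B.maximal k μ hμ _ (hmem w) ?_ ?_
      · rwa [hsind, sForm_congr_left (hind w)] at this
      · rintro _ ⟨z, hz, rfl⟩
        have h1 := hw ⟨z, hz⟩
        rw [aForm_congr_left (hind w), sForm_congr_left (hind w), haind _ ⟨z, hz⟩,
          hsind _ ⟨z, hz⟩]
        exact h1
      · intro j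
        rw [sForm_congr_left (hind w), ← coeff_apply hρ hθ]
        exact horth j) v
  have hs : P.sForm ρ θ k v v - B.projNormSq k v ≤ Λ⁻¹ * P.aForm ρ k v v := by
    rw [B.projNormSq_eq hρ hθ, inv_mul_eq_div, le_div_iff₀' hΛ]
    exact hgap
  have hp : 0 ≤ B.projNormSq k v := by
    rw [B.projNormSq_eq hρ hθ]
    exact Finset.sum_nonneg fun _ _ => sq_nonneg _
  have hp' : 0 ≤ Λ⁻¹ * B.projNormSq k v := mul_nonneg (inv_nonneg.2 hΛ.le) hp
  rw [localForm_self]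
  linarith

lemma totalEnergy_eq (B : P.AuxiliaryBasis ρ θ Λ) (v : T.femSubmodule) :
    B.totalEnergy v = ∑ l, B.localForm hρ hθ l v v := by
  rw [totalEnergy, energyForm_domain (P := P) hρ v.2.1 v.2.1, ← Finset.sum_add_distrib]
  simp only [localForm_self]

open Classical in
lemma outerEnergy_eq (B : P.AuxiliaryBasis ρ θ Λ) (k : ℕ) (v : T.femSubmodule) :
    B.outerEnergy i k v = ∑ l, if l ∉ P.layers i k then B.localForm hρ hθ l v v else 0 := by
  rw [outerEnergy, layerRegion, energyForm_domain_diff (P := P) hρ v.2.1 v.2.1,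
    ← Finset.sum_add_distrib, Finset.sum_filter]
  simp only [localForm_self]

lemma outerEnergy_le_totalEnergy (hρ : T.IsCoefficient K ρ)
    (hθ : ∀ l, T.IsPiecewiseLinear (θ l)) (B : P.AuxiliaryBasis ρ θ Λ) (k : ℕ)
    (v : T.femSubmodule) :
    B.outerEnergy i k v ≤ B.totalEnergy v := by
  classical
  rw [B.outerEnergy_eq hρ hθ, B.totalEnergy_eq hρ hθ]
  refine Finset.sum_le_sum fun l _ => ?_
  split_ifs
  · exact B.localForm_nonneg hρ hθ l v
  · exact le_rfl

/-- The minimized functional is the total energy minus a linear functional, up to a constant. -/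
lemma functional_eq (B : P.AuxiliaryBasis ρ θ Λ) (j : Fin (B.num i)) (v : T.femSubmodule) :
    B.functional i j v
      = ∑ l, B.localForm hρ hθ l v v - 2 * B.coeff hρ hθ i j v + 1 := by
  have h : P.sForm ρ θ i (B.proj i v - B.fn i j) (B.proj i v - B.fn i j)
      = B.projNormSq i v - 2 * B.coeff hρ hθ i j v + 1 := by
    rw [sForm_combination hρ hθ B i (fun l => B.coeff hρ hθ i l v - if l = j then 1 else 0),
      B.projNormSq_eq hρ hθ]
    · -- `φ_j` has the coefficients `δ_{lj}`
      simp only [sub_sq, Finset.sum_add_distrib, Finset.sum_sub_distrib, mul_ite, mul_one,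
        mul_zero, ite_pow, one_pow, Finset.sum_ite_eq', Finset.mem_univ, if_true, ne_eq,
        OfNat.ofNat_ne_zero, not_false_eq_true, zero_pow]
    · intro x
      simp only [Pi.sub_apply, proj, coeff_apply, sub_mul, Finset.sum_sub_distrib, ite_mul,
        one_mul, zero_mul, Finset.sum_ite_eq', Finset.mem_univ, if_true]
  rw [functional, h, ← B.totalEnergy_eq hρ hθ, totalEnergy,
    ← Finset.add_sum_erase _ _ (Finset.mem_univ i)]
  ring

/-- The variational equation of the global coarse basis function. -/
lemma sum_localForm_eq_coeff (B : P.AuxiliaryBasis ρ θ Λ) {j : Fin (B.num i)} {ψ : Space r → ℝ}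
    (hψ : B.IsGlobalBasisFunction i j ψ) (v : T.femSubmodule) :
    ∑ l, B.localForm hρ hθ l ⟨ψ, hψ.1⟩ v = B.coeff hρ hθ i j v := by
  have h := bilin_eq_of_minimizer (d := ∑ l, B.localForm hρ hθ l)
    (fun x y => by simp only [LinearMap.sum_apply, localForm_comm _ _ B _ x])
    (B.coeff hρ hθ i j) (u := ⟨ψ, hψ.1⟩) (fun w => by
      have h1 := hψ.2 w w.2
      rw [B.functional_eq hρ hθ j ⟨ψ, hψ.1⟩, B.functional_eq hρ hθ j w] at h1
      simp only [LinearMap.sum_apply]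
      linarith) v
  simpa only [LinearMap.sum_apply] using h

/-- The energy outside `Ω_{i,k+2}` is bounded by that of the two layers next to it. The variational
equation is tested with the interpolant of the basis function times a cutoff that vanishes on
`Ω_{i,k}` and equals one outside `Ω_{i,k+2}`. -/
lemma outerEnergy_step (B : P.AuxiliaryBasis ρ θ Λ) (hσ : T.ShapeRegular σ)
    (hρ : T.IsCoefficient K ρ) (hM : O.MultiplicityLE M) (hθ : O.IsPartitionOfUnity θ)
    (hΛ : 0 < Λ) {j : Fin (B.num i)} {ψ : Space r → ℝ} (hψ : B.IsGlobalBasisFunction i j ψ)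
    (k : ℕ) :
    B.outerEnergy i (k + 2) ψ ≤ cutoffConstant r σ K M * (1 + Λ⁻¹)
      * (B.outerEnergy i k ψ - B.outerEnergy i (k + 2) ψ) := by
  classical
  have hθ' := hθ.piecewiseLinear
  set C := cutoffConstant r σ K M * (1 + Λ⁻¹) with hC
  have hC1 : 1 ≤ C := one_le_mul_of_one_le_of_one_le (one_le_cutoffConstant r σ K M)
    (le_add_of_nonneg_right (inv_nonneg.2 hΛ.le))
  obtain ⟨v, hv, hnode⟩ := T.exists_femSpace_interpolating
    (fun a => (1 - ∑ l with l ∈ P.layers i (k + 1), θ l a) * ψ a)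
    (fun t ht a ha had => by rw [hψ.1.2 a had, mul_zero])
  let ψ' : T.femSubmodule := ⟨ψ, hψ.1⟩
  let v' : T.femSubmodule := ⟨v, hv⟩
  have hcut := cutoff_eqOn hθ i k hψ.1 hv hnode
  have hbound : ∀ l, B.localForm hρ hθ' l v' v' ≤ C * B.localForm hρ hθ' l ψ' ψ' := fun l =>
    calc _ ≤ P.aForm ρ l v v + P.sForm ρ θ l v v := B.localForm_self_le hρ hθ' l v'
      _ ≤ cutoffConstant r σ K M * (P.aForm ρ l ψ ψ + P.sForm ρ θ l ψ ψ) :=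
        subdomain_cutoff_le hσ hρ hM hθ _ hψ.1 hv hnode l
      _ ≤ cutoffConstant r σ K M * ((1 + Λ⁻¹) * B.localForm hρ hθ' l ψ' ψ') :=
        mul_le_mul_of_nonneg_left (B.aForm_add_sForm_le hρ hθ' hΛ l ψ')
          (zero_le_one.trans (one_le_cutoffConstant r σ K M))
      _ = _ := by rw [hC, mul_assoc]
  -- `v` vanishes on `Ω_i`, and so does the right-hand side of the variational equation
  have htest : ∑ l, B.localForm hρ hθ' l ψ' v' = 0 := by
    have hi : i ∈ P.layers i k := P.layers_mono i (Nat.zero_le k) rfl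
    rw [B.sum_localForm_eq_coeff hρ hθ' hψ v', coeff_apply,
      sForm_congr_left ((hcut i).1 hi)]
    simp [sForm]
  -- the three kinds of subdomains: in `Ω_{i,k}`, in the two layers around it, and outside
  have hterm : ∀ l, (1 + C) * (if l ∉ P.layers i (k + 2) then B.localForm hρ hθ' l ψ' ψ' else 0)
      - C * (if l ∉ P.layers i k then B.localForm hρ hθ' l ψ' ψ' else 0)
        ≤ B.localForm hρ hθ' l ψ' v' := by
    intro l
    by_cases h1 : l ∈ P.layers i k
    · have h2 : l ∈ P.layers i (k + 2) := P.layers_mono i (by omega) h1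
      have h3 : B.localForm hρ hθ' l ψ' v' = 0 := by
        rw [B.localForm_congr_right hρ hθ' l ψ' (w := 0) ((hcut l).1 h1), map_zero]
      simp [h1, h2, h3]
    · by_cases h2 : l ∈ P.layers i (k + 2)
      · -- `|d(ψ, v)| ≤ (d(ψ, ψ) + d(v, v)) / 2` for a semidefinite form `d`
        have h3 := B.localForm_nonneg hρ hθ' l (ψ' + v')
        rw [LinearMap.BilinForm.add_left, LinearMap.BilinForm.add_right,
          LinearMap.BilinForm.add_right, B.localForm_comm hρ hθ' l v' ψ'] at h3
        have h4 := hbound l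
        have h5 := mul_le_mul_of_nonneg_right hC1 (B.localForm_nonneg hρ hθ' l ψ')
        simp only [h1, h2, not_true_eq_false, not_false_eq_true, if_false, if_true, mul_zero]
        linarith
      · have h3 : B.localForm hρ hθ' l ψ' v' = B.localForm hρ hθ' l ψ' ψ' :=
          B.localForm_congr_right hρ hθ' l ψ' ((hcut l).2 h2)
        simp only [h1, h2, not_false_eq_true, if_true, h3]
        linarith
  have hsum := Finset.sum_le_sum fun l (_ : l ∈ Finset.univ) => hterm l
  rw [htest, Finset.sum_sub_distrib, ← Finset.mul_sum, ← Finset.mul_sum,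
    ← B.outerEnergy_eq hρ hθ' (k + 2) ψ', ← B.outerEnergy_eq hρ hθ' k ψ'] at hsum
  change (1 + C) * B.outerEnergy i (k + 2) ψ - C * B.outerEnergy i k ψ ≤ 0 at hsum
  linarith

/-- Iteration of the one-step bound, starting from the trivial bound by the total energy. -/
lemma outerEnergy_le (B : P.AuxiliaryBasis ρ θ Λ) (hσ : T.ShapeRegular σ)
    (hρ : T.IsCoefficient K ρ) (hM : O.MultiplicityLE M) (hθ : O.IsPartitionOfUnity θ)
    (hΛ : 0 < Λ) {j : Fin (B.num i)} {ψ : Space r → ℝ} (hψ : B.IsGlobalBasisFunction i j ψ)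
    (m : ℕ) :
    B.outerEnergy i (2 * m) ψ
      ≤ ((1 + (cutoffConstant r σ K M * (1 + Λ⁻¹))⁻¹) ^ m)⁻¹ * B.totalEnergy ψ := by
  have hC : 0 < cutoffConstant r σ K M * (1 + Λ⁻¹) :=
    mul_pos (zero_lt_one.trans_le (one_le_cutoffConstant r σ K M))
      (add_pos zero_lt_one (inv_pos.2 hΛ))
  set C := cutoffConstant r σ K M * (1 + Λ⁻¹)
  have hE : 0 < 1 + C⁻¹ := add_pos zero_lt_one (inv_pos.2 hC)
  rw [le_inv_mul_iff₀ (pow_pos hE m)]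
  induction m with
  | zero =>
    rw [pow_zero, one_mul]
    exact outerEnergy_le_totalEnergy hρ hθ.piecewiseLinear B 0 ⟨ψ, hψ.1⟩
  | succ m ih =>
    have h1 : B.outerEnergy i (2 * m + 2) ψ
        ≤ C * (B.outerEnergy i (2 * m) ψ - B.outerEnergy i (2 * m + 2) ψ) :=
      B.outerEnergy_step hσ hρ hM hθ hΛ hψ (2 * m)
    have h2 : (1 + C⁻¹) * B.outerEnergy i (2 * (m + 1)) ψ ≤ B.outerEnergy i (2 * m) ψ := by
      rw [mul_add_one]
      rw [← inv_mul_le_iff₀ hC] at h1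
      linarith
    calc (1 + C⁻¹) ^ (m + 1) * B.outerEnergy i (2 * (m + 1)) ψ
        = (1 + C⁻¹) ^ m * ((1 + C⁻¹) * B.outerEnergy i (2 * (m + 1)) ψ) := by ring
      _ ≤ (1 + C⁻¹) ^ m * B.outerEnergy i (2 * m) ψ :=
        mul_le_mul_of_nonneg_left h2 (pow_pos hE m).le
      _ ≤ _ := ih

end AuxiliaryBasis

end Subdomains

end MultiscaleSchwarz

theorem mainTheorem3 (r : ℕ) (σ K : ℝ) (M : ℕ) :
    ∃ C : ℝ, 0 < C ∧
      ∀ (T : MultiscaleSchwarz.Triangulation r), T.ShapeRegular σ →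
      ∀ (ρ : MultiscaleSchwarz.Space r → ℝ), T.IsCoefficient K ρ →
      ∀ (N : ℕ) (P : MultiscaleSchwarz.Subdomains T N) (O : MultiscaleSchwarz.Overlap P),
        O.MultiplicityLE M →
      ∀ (θ : Fin N → MultiscaleSchwarz.Space r → ℝ), O.IsPartitionOfUnity θ →
      ∀ (Λ : ℝ), 0 < Λ →
      ∀ (B : P.AuxiliaryBasis ρ θ Λ) (i : Fin N) (j : Fin (B.num i))
        (ψ : MultiscaleSchwarz.Space r → ℝ), B.IsGlobalBasisFunction i j ψ →
        1 < 1 + (C * (1 + Λ⁻¹))⁻¹ ∧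
        ∀ m : ℕ, 1 ≤ m →
          B.outerEnergy i (2 * m) ψ ≤ ((1 + (C * (1 + Λ⁻¹))⁻¹) ^ m)⁻¹ * B.totalEnergy ψ := by
  have hC : 0 < MultiscaleSchwarz.cutoffConstant r σ K M :=
    zero_lt_one.trans_le (MultiscaleSchwarz.one_le_cutoffConstant r σ K M)
  refine ⟨MultiscaleSchwarz.cutoffConstant r σ K M, hC, ?_⟩
  intro T hσ ρ hρ N P O hM θ hθ Λ hΛ B i j ψ hψ
  refine ⟨lt_add_of_pos_right _ (inv_pos.2 (mul_pos hC (add_pos zero_lt_one (inv_pos.2 hΛ)))), ?_⟩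
  exact fun m _ => B.outerEnergy_le hσ hρ hM hθ hΛ hψ m
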